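/- **Group-linear estimator.** Let $V=(V_1,\dots,V_n)$ with $V_i>0$ be known, let $J_1,\dots,J_m\subset\mathbb R$ be pairwise disjoint intervals, and put $\mathcal I_k=\{i: V_i\in J_k\}$, $n_k=|\mathcal I_k|$, $\bar V_k=n_k^{-1}\sum_{i\in\mathcal I_k}V_i$, $\bar X_k=n_k^{-1}\sum_{i\in\mathcal I_k}X_i$, $s_k^2=\sum_{i\in\mathcal I_k}(X_i-\bar X_k)^2/(\max(n_k,2)-1)$ and $$c_k=\Big\{1-\frac{2\,(\max_{i\in\mathcal I_k}V_i/\bar V_k)}{n_k-1}\Big\}_+ .$$ The group-linear estimator $\hat\theta$ is given by $\hat\theta_i=X_i-\min(1,c_k\bar V_k/s_k^2)(X_i-\bar X_k)$ if $i\in\mathcal I_k$, and $\hat\theta_i=X_i$ if $V_i\notin\bigcup_kJ_k$ (so that $\hat\theta_i=X_i$ also if $n_k=1$ or $s_k^2=0$). **Theorem.** (i) Let $\theta\in\mathbb R^n$ and $V\in(0,\infty)^n$ be deterministic and let $X_i\sim N(\theta_i,V_i)$ be independent. Then for every $\theta$ $$\frac1n\sum_{i=1}^n E(\hat\theta_i-\theta_i)^2\le\frac1n\sum_{i=1}^nE(X_i-\theta_i)^2=\frac1n\sum_{i=1}^nV_i=\bar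 V ,$$ and $\hat\theta$ is minimax: for the given $V$, its maximal risk over $\theta\in\mathbb R^n$ equals the infimum of the maximal risk over all (possibly randomized) estimators. (ii) Let $(X_i,\theta_i,V_i)$, $i=1,2,\dots$, be i.i.d. copies of a random vector $(Y,\xi,A)$ whose law does not depend on $n$, with $A>0$ and $Y\mid(\xi,A)\sim N(\xi,A)$. Fix a regular conditional distribution of $\xi$ given $A=v$; it determines the conditional law of $(\xi,Y)$ given $A=v$, and the product over $i\le n$ of these laws at $v=V_i$ is a regular conditional distribution of $(\theta_i,X_i)_{i\le n}$ given $V=(V_1,\dots,V_n)$. All conditional quantities below refer to these versions. Put $$a^*(v)=E(Y\mid A=v),\qquad b^*(v)=\frac{v}{\mathrm{Var}(Y\mid A=v)},\qquad r(a,b\mid v)=E\big[\{Y-b(A)(Y-a(A))-\xi\}^2\,\big|\,A=v\big],$$ with $b^*(v)=0$ if $\mathrm{Var}(Y\mid A=v)=\infty$. Let $V_1,V_2,\dots$ be any sequence in a set $S\subset(0,\infty)$ on which $a^*$ and $b^*$ are uniformly continuous, and for each $n$ let $J_k=J_{n,k}$, $1\le k\le m=m_n$, be pairwise disjoint intervals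 of length $|J_k|$ such that, as $n\to\infty$, $$\max_{k\le m}|J_k|\to0,\quad \min_{k\le m}n_k\to\infty,\quad \limsup_{n\to\infty}\frac1n\sum_{i=1}^nV_i<\infty,\quad \limsup_{n\to\infty}\frac1n\sum_{i=1}^nV_i\,I\{V_i\notin\textstyle\bigcup_{k\le m}J_k\}=0 .$$ Then $$\frac1n\sum_{i=1}^nE\big[(\hat\theta_i-\theta_i)^2\,\big|\,V_1,\dots,V_n\big]\le\frac1n\sum_{i=1}^nr(a^*,b^*\mid V_i)+o(1)\qquad(n\to\infty).$$ -/

import Mathlib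

open MeasureTheory ProbabilityTheory Filter Topology
open scoped ENNReal NNReal

noncomputable section

namespace GroupLinear

/-! ### The group-linear estimator -/

/-- A finite family of pairwise disjoint intervals of the real line. -/
structure IsBinning {m : ℕ} (J : Fin m → Set ℝ) : Prop where
  interval : ∀ k, (J k).OrdConnected
  disjoint : Pairwise fun k l => Disjoint (J k) (J l)

open Classical in
/-- The index set `I_k = {i : V_i ∈ J_k}`. -/
def binIdx {n m : ℕ} (J : Fin m → Set ℝ) (V : Fin n → ℝ) (k : Fin m) : Finset (Fin n) :=
  {i | V i ∈ J k}

/-- The bin size `n_k`. -/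
def binSize {n m : ℕ} (J : Fin m → Set ℝ) (V : Fin n → ℝ) (k : Fin m) : ℕ :=
  (binIdx J V k).card

/-- The average of `x` over the bin `I_k`; it gives `V̄_k` and `X̄_k`. -/
def binMean {n m : ℕ} (J : Fin m → Set ℝ) (V : Fin n → ℝ) (x : Fin n → ℝ) (k : Fin m) : ℝ :=
  (∑ i ∈ binIdx J V k, x i) / (binSize J V k : ℝ)

/-- `s_k² = ∑_{i ∈ I_k} (X_i - X̄_k)² / (max n_k 2 - 1)`. -/
def binVar {n m : ℕ} (J : Fin m → Set ℝ) (V : Fin n → ℝ) (x : Fin n → ℝ) (k : Fin m) : ℝ :=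
  (∑ i ∈ binIdx J V k, (x i - binMean J V x k) ^ 2) / (max (binSize J V k : ℝ) 2 - 1)

/-- `max_{i ∈ I_k} V_i`; it is only used for nonempty bins. -/
def binMax {n m : ℕ} (J : Fin m → Set ℝ) (V : Fin n → ℝ) (k : Fin m) : ℝ :=
  sSup (V '' (binIdx J V k : Set (Fin n)))

/-- `c_k = {1 - 2 (max_{i ∈ I_k} V_i / V̄_k) / (n_k - 1)}_+`. For `n_k = 1` the value is
immaterial, because then `X_i - X̄_k = 0` for the only `i ∈ I_k`. -/
def shrinkConst {n m : ℕ} (J : Fin m → Set ℝ) (V : Fin n → ℝ) (k : Fin m) : ℝ :=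
  max (1 - 2 * (binMax J V k / binMean J V V k) / ((binSize J V k : ℝ) - 1)) 0

/-- The shrinkage factor `min (1, c_k V̄_k / s_k²)`. If `s_k² = 0` its value is immaterial,
because then `X_i = X̄_k` for all `i ∈ I_k`. -/
def shrinkFactor {n m : ℕ} (J : Fin m → Set ℝ) (V : Fin n → ℝ) (x : Fin n → ℝ) (k : Fin m) : ℝ :=
  min 1 (shrinkConst J V k * binMean J V V k / binVar J V x k)

open Classical in
/-- The group-linear estimator: `X_i - min (1, c_k V̄_k / s_k²) (X_i - X̄_k)` for `i ∈ I_k`, and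
`X_i` if `V_i` lies in no bin. The bins are disjoint, so the sum has at most one nonzero term. -/
def glEstimator {n m : ℕ} (J : Fin m → Set ℝ) (V : Fin n → ℝ) (x : Fin n → ℝ) : Fin n → ℝ :=
  fun i => x i - ∑ k, if i ∈ binIdx J V k
    then shrinkFactor J V x k * (x i - binMean J V x k) else 0

/-- The normalized squared error loss `L_n(θ, t) = n⁻¹ ∑ (t_i - θ_i)²`. -/
def loss {n : ℕ} (θ t : Fin n → ℝ) : ℝ≥0∞ :=
  ENNReal.ofReal ((∑ i, (t i - θ i) ^ 2) / (n : ℝ))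

/-! ### Product kernels -/

theorem measurable_pi_kernel {n : ℕ} {α β : Type*} [MeasurableSpace α] [MeasurableSpace β]
    (κ : Fin n → Kernel α β) [∀ i, IsMarkovKernel (κ i)] :
    Measurable fun a => Measure.pi fun i => κ i a := by
  refine Measurable.measure_of_isPiSystem_of_isProbabilityMeasure
    generateFrom_pi.symm isPiSystem_pi ?_
  rintro _ ⟨s, hs, rfl⟩
  simp only [Measure.pi_pi]
  exact Finset.measurable_prod _ fun i _ => (κ i).measurable_coe (hs i (Set.mem_univ i))

/-- The product kernel `a ↦ ⊗_i κ_i(a)`. -/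
def piKernel {n : ℕ} {α β : Type*} [MeasurableSpace α] [MeasurableSpace β]
    (κ : Fin n → Kernel α β) [∀ i, IsMarkovKernel (κ i)] : Kernel α (Fin n → β) where
  toFun a := Measure.pi fun i => κ i a
  measurable' := measurable_pi_kernel κ

/-- The normal kernel `(v, t) ↦ N(t, v)`. -/
def normalKernel : Kernel (ℝ × ℝ) ℝ where
  toFun p := gaussianReal p.2 p.1.toNNReal
  measurable' := measurable_gaussianReal.comp
    (measurable_snd.prodMk (measurable_real_toNNReal.comp measurable_fst))

instance : IsMarkovKernel normalKernel where
  isProbabilityMeasure p := by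
    change IsProbabilityMeasure (gaussianReal p.2 p.1.toNNReal)
    infer_instance

/-! ### Deterministic means and variances -/

/-- The Gaussian model with known variances `V`: `θ` is sent to the law of independent
`X_i ∼ N(θ_i, V_i)`. -/
def gaussModel {n : ℕ} (V : Fin n → ℝ) : Kernel (Fin n → ℝ) (Fin n → ℝ) :=
  piKernel fun i => normalKernel.comap (fun θ : Fin n → ℝ => (V i, θ i))
    (measurable_const.prodMk (measurable_pi_apply i))

/-- The risk `R_n(θ, δ) = E_θ L_n(θ, δ(X))` of a nonrandomized estimator `δ`. -/
def risk {n : ℕ} (V θ : Fin n → ℝ) (δ : (Fin n → ℝ) → Fin n → ℝ) : ℝ≥0∞ :=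
  ∫⁻ x, loss θ (δ x) ∂(gaussModel V θ)

/-- `δ` is minimax: it is measurable, and its maximal risk over `θ ∈ ℝⁿ` is the minimax risk,
the infimum of the maximal risk over all (possibly randomized) estimators. -/
def IsMinimax {n : ℕ} (V : Fin n → ℝ) (δ : (Fin n → ℝ) → Fin n → ℝ) : Prop :=
  Measurable δ ∧ ⨆ θ, risk V θ δ = minimaxRisk loss (gaussModel V)

/-! ### The i.i.d. model -/

/-- `(X_i, θ_i, V_i)` are i.i.d. vectors with `V_i > 0` and `X_i | (θ_i, V_i) ∼ N(θ_i, V_i)`. -/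
structure IsIIDModel {Ω : Type*} [MeasurableSpace Ω] (P : Measure Ω) (X θ V : ℕ → Ω → ℝ) :
    Prop where
  measurable_X : ∀ i, Measurable (X i)
  measurable_θ : ∀ i, Measurable (θ i)
  measurable_V : ∀ i, Measurable (V i)
  indep : iIndepFun (fun i ω => (X i ω, θ i ω, V i ω)) P
  ident : ∀ i, IdentDistrib (fun ω => (X i ω, θ i ω, V i ω)) (fun ω => (X 0 ω, θ 0 ω, V 0 ω)) P P
  pos : ∀ i, ∀ᵐ ω ∂P, 0 < V i ω
  normal : ∀ i, HasCondDistrib (X i) (fun ω => (V i ω, θ i ω)) normalKernel P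

/-- The conditional law of `(ξ, Y)` given `A = v`, where `κ v` is the conditional law of `ξ` given
`A = v`, and `Y | (ξ, A) ∼ N(ξ, A)`. -/
def popKernel (κ : Kernel ℝ ℝ) : Kernel ℝ (ℝ × ℝ) := κ ⊗ₖ normalKernel

instance (κ : Kernel ℝ ℝ) [IsMarkovKernel κ] : IsMarkovKernel (popKernel κ) := by
  unfold popKernel; infer_instance

/-- `a*(v) = E(Y | A = v)`. -/
def aStar (κ : Kernel ℝ ℝ) (v : ℝ) : ℝ := ∫ p, p.2 ∂(popKernel κ v)

/-- `b*(v) = v / Var(Y | A = v)`. If the conditional variance is infinite, `Var` is `0` by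
convention and hence `b*(v) = 0`, which is also the value of `v / ∞`. -/
def bStar (κ : Kernel ℝ ℝ) (v : ℝ) : ℝ :=
  v / variance (fun p : ℝ × ℝ => p.2) (popKernel κ v)

/-- `r(a, b | v) = E[(Y - b(A) (Y - a(A)) - ξ)² | A = v]`. -/
def condBayesRisk (κ : Kernel ℝ ℝ) (a b : ℝ → ℝ) (v : ℝ) : ℝ≥0∞ :=
  ∫⁻ p, ENNReal.ofReal ((p.2 - b v * (p.2 - a v) - p.1) ^ 2) ∂(popKernel κ v)

/-- The conditional law of `((θ_i, X_i))_{i < n}` given `V = v`: the product over `i` of the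
conditional laws of `(ξ, Y)` given `A = v_i`. -/
def sampleKernel (κ : Kernel ℝ ℝ) [IsMarkovKernel κ] (n : ℕ) :
    Kernel (Fin n → ℝ) (Fin n → ℝ × ℝ) :=
  piKernel fun i => (popKernel κ).comap (fun v : Fin n → ℝ => v i) (measurable_pi_apply i)

/-- The conditional risk `n⁻¹ ∑ E[(θ̂_i - θ_i)² | V = v]` of the group-linear estimator. -/
def condRisk (κ : Kernel ℝ ℝ) [IsMarkovKernel κ] {n m : ℕ} (J : Fin m → Set ℝ)
    (v : Fin n → ℝ) : ℝ≥0∞ :=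
  ∫⁻ z, loss (fun i => (z i).1) (glEstimator J v fun i => (z i).2) ∂(sampleKernel κ n v)

open Classical in
/-- The conditions on a sequence `v_0, v_1, …` of variances and on the bins `J_{n,k}`, `k < m_n`,
used for the first `n` observations. -/
structure LocalCond (v : ℕ → ℝ) (m : ℕ → ℕ) (J : ∀ n, Fin (m n) → Set ℝ) : Prop where
  /-- the maximal bin length tends to `0` -/
  length : ∀ δ : ℝ, 0 < δ → ∀ᶠ n in atTop, ∀ k, volume (J n k) ≤ ENNReal.ofReal δ
  /-- the minimal bin size tends to infinity -/
  size : ∀ N : ℕ, ∀ᶠ n in atTop, ∀ k, N ≤ binSize (J n) (fun i : Fin n => v i) k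
  /-- the averages of the variances stay bounded -/
  bounded : ∃ C : ℝ, ∀ᶠ n : ℕ in atTop, (∑ i : Fin n, v i) / (n : ℝ) ≤ C
  /-- the contribution of the variances outside the bins vanishes -/
  outside : Tendsto
    (fun n : ℕ => (∑ i : Fin n, if v i ∈ ⋃ k, J n k then 0 else v i) / (n : ℝ)) atTop (𝓝 0)

end GroupLinear

end

noncomputable section

namespace GroupLinear

/-! ### Product kernels -/

/-! Both parts rest on one inequality, proved with Stein's identity. In a bin with sum of squared
deviations `S`, the estimator subtracts `E (x_i - x̄) / max S E`, where `E = (n_k - 1) c_k V̄_k`.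
This correction is bounded and continuous, and in each coordinate it is differentiable off at most
two points, so Stein's identity gives an unbiased estimate of the change in risk. The constant `c_k`
is such that this estimate is at most `-2 E q + q² S` pointwise, for every `q ∈ [0, 1]`
(`sum_shrinkTerm_le`). Up to the replacement of `∑ V_i` by `E`, this bound is the risk change under
linear shrinkage by the fixed factor `q`.

For (i), `q = 0` gives risk at most `V̄` for every mean vector. Under independent `N(0, T)` priors
the Bayes risk is at least the average of `V_i T / (V_i + T)`, which tends to `V̄` as `T → ∞`. Hence
the minimax risk is at least `V̄`, and the estimator attains it.

For (ii), the inequality is averaged over the means, with `q_k` the smallest value of `b*` in the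
bin. Since `Var(Y | A = v) = v / b*(v)` when `b*(v) > 0`, the term `q² E S` costs at most `∑ (q V_i
+ α²)`, where `α` bounds the oscillation of `a*` in the bin. As `E` is close to `∑ V_i`, about `∑
V_i (1 - q)` remains, while the oracle risk is exactly `v (1 - b*(v))`. Uniform continuity controls
`b* - q_k`. No moments of `ξ` are needed: infinite variance forces `q_k = 0`. `condRisk_le` is the
resulting finite-sample bound. -/

theorem lintegral_pi_prod {n : ℕ} {α : Type*} [MeasurableSpace α] (μ : Fin n → Measure α)
    [∀ i, IsProbabilityMeasure (μ i)] {f : Fin n → α → ℝ≥0∞} (hf : ∀ i, Measurable (f i)) :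
    ∫⁻ x, ∏ i, f i (x i) ∂Measure.pi μ = ∏ i, ∫⁻ t, f i t ∂μ i := by
  have h := lintegral_prod_eq_prod_lintegral_of_indepFun (μ := Measure.pi μ) Finset.univ
    (fun i (x : Fin n → α) => f i (x i))
    (iIndepFun_pi (μ := μ) (X := f) fun i => (hf i).aemeasurable)
    fun i => (hf i).comp (measurable_pi_apply i)
  rw [h]
  exact Finset.prod_congr rfl fun i _ => (measurePreserving_eval μ i).lintegral_comp (hf i)

/-- The law of independent pairs is the product of the first marginals composed with the product
kernel of the conditional laws. -/
theorem map_pi_compProd {n : ℕ} {α β : Type*} [MeasurableSpace α] [MeasurableSpace β]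
    (μ : Fin n → Measure α) [∀ i, IsProbabilityMeasure (μ i)]
    (κ : Fin n → Kernel α β) [∀ i, IsMarkovKernel (κ i)] :
    (Measure.pi fun i => μ i ⊗ₘ κ i).map (MeasurableEquiv.arrowProdEquivProdArrow α β (Fin n)) =
      Measure.pi μ ⊗ₘ
        piKernel fun i => (κ i).comap (fun a : Fin n → α => a i) (measurable_pi_apply i) := by
  set η := piKernel fun i => (κ i).comap (fun a : Fin n → α => a i) (measurable_pi_apply i)
    with hη
  have : IsMarkovKernel η := ⟨fun a => by
    change IsProbabilityMeasure (Measure.pi fun i => κ i (a i)); infer_instance⟩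
  set e := MeasurableEquiv.arrowProdEquivProdArrow α β (Fin n) with he
  suffices h : (Measure.pi fun i => μ i ⊗ₘ κ i) = (Measure.pi μ ⊗ₘ η).map e.symm by
    rw [h, e.map_map_symm]
  -- Measurable rectangles form a generating π-system in each factor, so it suffices to compare the
  -- two laws on boxes of rectangles, where both factor over the coordinates.
  refine Measure.pi_eq_generateFrom (C := fun _ => Set.image2 (· ×ˢ ·)
    { s : Set α | MeasurableSet s } { t : Set β | MeasurableSet t })
    (fun _ => generateFrom_prod) (fun _ => isPiSystem_prod)
    (fun i => ⟨fun _ => Set.univ, fun _ => ⟨Set.univ, .univ, Set.univ, .univ, by simp⟩,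
      fun _ => measure_lt_top _ _, Set.iUnion_const _⟩) ?_
  intro s hs
  choose A hA B hB hAB using hs
  obtain rfl : (fun i => A i ×ˢ B i) = s := funext hAB
  have hpre : e.symm ⁻¹' (Set.univ.pi fun i => A i ×ˢ B i) =
      Set.univ.pi A ×ˢ Set.univ.pi B := by
    ext p
    simp [e, MeasurableEquiv.arrowProdEquivProdArrow, Equiv.arrowProdEquivProdArrow, forall_and]
  rw [e.symm.map_apply, hpre, Measure.compProd_apply_prod (.univ_pi hA) (.univ_pi hB)]
  have hind : ∀ a : Fin n → α, (Set.univ.pi A).indicator (fun a => η a (Set.univ.pi B)) a =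
      ∏ i, (A i).indicator (fun t => κ i t (B i)) (a i) := by
    intro a
    by_cases ha : a ∈ Set.univ.pi A
    · rw [Set.indicator_of_mem ha]
      change (Measure.pi fun i => κ i (a i)) _ = _
      rw [Measure.pi_pi]
      exact Finset.prod_congr rfl fun i _ => by rw [Set.indicator_of_mem (ha i (Set.mem_univ i))]
    · rw [Set.indicator_of_notMem ha]
      simp only [Set.mem_univ_pi, not_forall] at ha
      obtain ⟨i, hi⟩ := ha
      exact (Finset.prod_eq_zero (Finset.mem_univ i) (Set.indicator_of_notMem hi _)).symm
  rw [← lintegral_indicator (.univ_pi hA)]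
  simp_rw [hind]
  rw [lintegral_pi_prod _ fun i => ((κ i).measurable_coe (hB i)).indicator (hA i)]
  refine Finset.prod_congr rfl fun i _ => ?_
  rw [lintegral_indicator (hA i), Measure.compProd_apply_prod (hA i) (hB i)]

instance {n : ℕ} {α β : Type*} [MeasurableSpace α] [MeasurableSpace β]
    (κ : Fin n → Kernel α β) [∀ i, IsMarkovKernel (κ i)] : IsMarkovKernel (piKernel κ) :=
  ⟨fun a => by change IsProbabilityMeasure (Measure.pi fun i => κ i a); infer_instance⟩

instance {n : ℕ} (V : Fin n → ℝ) : IsMarkovKernel (gaussModel V) := by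
  unfold gaussModel; infer_instance

instance (κ : Kernel ℝ ℝ) [IsMarkovKernel κ] (n : ℕ) : IsMarkovKernel (sampleKernel κ n) := by
  unfold sampleKernel; infer_instance

theorem gaussModel_apply {n : ℕ} (V θ : Fin n → ℝ) :
    gaussModel V θ = Measure.pi fun i => gaussianReal (θ i) (V i).toNNReal := rfl

theorem popKernel_apply (κ : Kernel ℝ ℝ) [IsMarkovKernel κ] (v : ℝ) :
    popKernel κ v = κ v ⊗ₘ normalKernel.sectR v :=
  Kernel.compProd_apply_eq_compProd_sectR ..

theorem lintegral_popKernel (κ : Kernel ℝ ℝ) [IsMarkovKernel κ] (v : ℝ) {f : ℝ × ℝ → ℝ≥0∞}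
    (hf : Measurable f) :
    ∫⁻ p, f p ∂popKernel κ v = ∫⁻ t, ∫⁻ y, f (t, y) ∂gaussianReal t v.toNNReal ∂κ v := by
  rw [popKernel_apply, Measure.lintegral_compProd hf]
  rfl

/-- Given the variances, the means have law `⊗ κ(v_i)` and the observations follow the Gaussian
model given the means. -/
theorem map_sampleKernel (κ : Kernel ℝ ℝ) [IsMarkovKernel κ] {n : ℕ} (v : Fin n → ℝ) :
    (sampleKernel κ n v).map (MeasurableEquiv.arrowProdEquivProdArrow ℝ ℝ (Fin n)) =
      (Measure.pi fun i => κ (v i)) ⊗ₘ gaussModel v := by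
  have h := map_pi_compProd (fun i => κ (v i)) (fun i => normalKernel.sectR (v i))
  simp_rw [← popKernel_apply] at h
  exact h

theorem lintegral_sampleKernel (κ : Kernel ℝ ℝ) [IsMarkovKernel κ] {n : ℕ} (v : Fin n → ℝ)
    {f : (Fin n → ℝ) → (Fin n → ℝ) → ℝ≥0∞} (hf : Measurable (Function.uncurry f)) :
    ∫⁻ z, f (fun i => (z i).1) (fun i => (z i).2) ∂sampleKernel κ n v =
      ∫⁻ θ, ∫⁻ x, f θ x ∂gaussModel v θ ∂Measure.pi fun i => κ (v i) := by
  have h := Measure.lintegral_compProd (μ := Measure.pi fun i => κ (v i)) (κ := gaussModel v) hf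
  rw [← map_sampleKernel, lintegral_map hf (MeasurableEquiv.measurable _)] at h
  exact h

theorem lintegral_sampleKernel_eval (κ : Kernel ℝ ℝ) [IsMarkovKernel κ] {n : ℕ} (v : Fin n → ℝ)
    (i : Fin n) {f : ℝ × ℝ → ℝ≥0∞} (hf : Measurable f) :
    ∫⁻ z, f (z i) ∂sampleKernel κ n v = ∫⁻ p, f p ∂popKernel κ (v i) :=
  (measurePreserving_eval (fun i => popKernel κ (v i)) i).lintegral_comp hf

theorem hasCondDistrib_popKernel {Ω : Type*} [MeasurableSpace Ω] {P : Measure Ω}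
    [IsProbabilityMeasure P] {X θ V : Ω → ℝ} {κ : Kernel ℝ ℝ} [IsMarkovKernel κ]
    (hθ : HasCondDistrib θ V κ P)
    (hX : HasCondDistrib X (fun ω => (V ω, θ ω)) normalKernel P) :
    HasCondDistrib (fun ω => (θ ω, X ω)) V (popKernel κ) P := by
  have hV := hθ.aemeasurable_fst
  have hθm := hθ.aemeasurable_snd
  have hXm := hX.aemeasurable_snd
  refine ⟨by fun_prop, ?_⟩
  have h := hX.map_eq
  rw [hθ.map_eq] at h
  rw [popKernel, ← Measure.compProd_assoc', ← h,
    AEMeasurable.map_map_of_aemeasurable (by fun_prop) (by fun_prop)]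
  rfl

/-- Identical distribution transfers `κ` from index `0` to every index, and the chain rule gives the
conditional law of each pair. Independence makes the joint law a product, which `map_pi_compProd`
disintegrates over the variances. -/
theorem hasCondDistrib_sampleKernel {Ω : Type*} [MeasurableSpace Ω] {P : Measure Ω}
    [IsProbabilityMeasure P] {X θ V : ℕ → Ω → ℝ} {κ : Kernel ℝ ℝ} [IsMarkovKernel κ]
    (h : IsIIDModel P X θ V) (hκ : HasCondDistrib (θ 0) (V 0) κ P) (n : ℕ) :
    HasCondDistrib (fun ω (i : Fin n) => (θ i ω, X i ω)) (fun ω (i : Fin n) => V i ω)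
      (sampleKernel κ n) P := by
  have hX := h.measurable_X
  have hθ := h.measurable_θ
  have hV := h.measurable_V
  have hlaw : ∀ i, P.map (fun ω => (V i ω, (θ i ω, X i ω))) = P.map (V i) ⊗ₘ popKernel κ := by
    intro i
    refine (hasCondDistrib_popKernel ⟨by fun_prop, ?_⟩ (h.normal i)).map_eq
    have e1 := ((h.ident i).comp (u := fun p : ℝ × ℝ × ℝ => (p.2.2, p.2.1))
      (by fun_prop)).map_eq
    have e2 := ((h.ident i).comp (u := fun p : ℝ × ℝ × ℝ => p.2.2) (by fun_prop)).map_eq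
    simp only [Function.comp_def] at e1 e2
    rw [e1, e2]
    exact hκ.map_eq
  have hind : iIndepFun (fun (i : Fin n) ω => (V i ω, (θ i ω, X i ω))) P :=
    (h.indep.precomp (g := fun i : Fin n => (i : ℕ)) Fin.val_injective).comp
      (fun _ (p : ℝ × ℝ × ℝ) => (p.2.2, (p.2.1, p.1))) fun _ => by fun_prop
  have hindV : iIndepFun (fun (i : Fin n) ω => V i ω) P :=
    hind.comp (fun _ p => p.1) fun _ => by fun_prop
  have hVlaw := (iIndepFun_iff_map_fun_eq_pi_map (fun i : Fin n => (hV i).aemeasurable)).1 hindV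
  have hjoint := (iIndepFun_iff_map_fun_eq_pi_map
    (fun i : Fin n => ((hV i).prodMk ((hθ i).prodMk (hX i))).aemeasurable)).1 hind
  have hprob : ∀ i, IsProbabilityMeasure (P.map (V i)) := fun i =>
    Measure.isProbabilityMeasure_map (hV i).aemeasurable
  refine ⟨by fun_prop, ?_⟩
  rw [hVlaw]
  have hmap := map_pi_compProd (fun i : Fin n => P.map (V i)) (fun _ => popKernel κ)
  simp_rw [← hlaw] at hmap
  rw [← hjoint, Measure.map_map (MeasurableEquiv.measurable _) (by fun_prop)] at hmap
  exact hmap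

/-! ### Stein's identity -/

theorem hasDerivAt_gaussianPDFReal (μ : ℝ) (v : ℝ≥0) (t : ℝ) :
    HasDerivAt (gaussianPDFReal μ v) (-((t - μ) / v) * gaussianPDFReal μ v t) t := by
  have h1 : HasDerivAt (fun x : ℝ => -(x - μ) ^ 2 / (2 * v)) (-((t - μ) / v)) t := by
    have h := ((((hasDerivAt_id t).sub_const μ).pow 2).neg).div_const (2 * (v : ℝ))
    refine h.congr_deriv ?_
    -- For `v = 0` both sides vanish, since division by zero gives zero.
    by_cases hv : (v : ℝ) = 0
    · simp [hv]
    · simp; field_simp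
  have h2 := (h1.exp).const_mul ((√(2 * Real.pi * v))⁻¹)
  refine h2.congr_deriv ?_
  simp only [gaussianPDFReal]
  ring

theorem tendsto_gaussianPDFReal_cocompact (μ : ℝ) {v : ℝ≥0} (hv : v ≠ 0) :
    Tendsto (gaussianPDFReal μ v) (cocompact ℝ) (𝓝 0) := by
  have hv' : (0 : ℝ) < v := by positivity
  have h1 : Tendsto (fun x : ℝ => (x - μ) ^ 2 / (2 * v)) (cocompact ℝ) atTop := by
    refine Tendsto.atTop_div_const (by positivity) ?_
    have h2 : Tendsto (fun x : ℝ => |x - μ|) (cocompact ℝ) atTop := by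
      simpa [Real.dist_eq] using tendsto_dist_right_cocompact_atTop μ
    exact ((tendsto_pow_atTop two_ne_zero).comp h2).congr fun x => sq_abs _
  have h3 := (Real.tendsto_exp_neg_atTop_nhds_zero.comp h1).const_mul ((√(2 * Real.pi * v))⁻¹)
  rw [mul_zero] at h3
  refine h3.congr fun x => ?_
  simp [gaussianPDFReal, neg_div]

/-- **Stein's identity** for a bounded continuous function with a bounded derivative off a
countable set. -/
theorem integral_sub_mul_gaussianReal (μ : ℝ) {v : ℝ≥0} (hv : v ≠ 0) {f f' : ℝ → ℝ} {s : Set ℝ}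
    (hs : s.Countable) (hf : Continuous f) (hd : ∀ t ∉ s, HasDerivAt f (f' t) t)
    (hf' : Measurable f') {K K' : ℝ} (hK : ∀ t, |f t| ≤ K) (hK' : ∀ t, |f' t| ≤ K') :
    ∫ t, (t - μ) * f t ∂gaussianReal μ v = v * ∫ t, f' t ∂gaussianReal μ v := by
  have hv' : (v : ℝ) ≠ 0 := by positivity
  set φ := gaussianPDFReal μ v with hφ
  have hφc : Continuous φ :=
    continuous_iff_continuousAt.2 fun t => (hasDerivAt_gaussianPDFReal μ v t).continuousAt
  have hφi : Integrable φ := integrable_gaussianPDFReal μ v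
  have hid : Integrable (fun t : ℝ => t - μ) (gaussianReal μ v) :=
    ((memLp_id_gaussianReal 1).integrable (by norm_num)).sub (integrable_const μ)
  have hφt : Integrable fun t => φ t * (t - μ) := by
    rw [gaussianReal_of_var_ne_zero μ hv, integrable_withDensity_iff_integrable_smul₀'
      (measurable_gaussianPDF μ v).aemeasurable (ae_of_all _ fun _ => gaussianPDF_lt_top)] at hid
    simpa [toReal_gaussianPDF] using hid
  have hi1 : Integrable fun t => f' t * φ t :=
    hφi.bdd_mul (c := K') hf'.aestronglyMeasurable (ae_of_all _ hK')
  have hi2 : Integrable fun t => f t * (φ t * (t - μ)) :=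
    hφt.bdd_mul (c := K) hf.aestronglyMeasurable (ae_of_all _ hK)
  have hint : Integrable fun t => f' t * φ t - (v : ℝ)⁻¹ * (f t * (φ t * (t - μ))) :=
    hi1.sub (hi2.const_mul _)
  have hlim : Tendsto (fun t => f t * φ t) (cocompact ℝ) (𝓝 0) := by
    have h := (tendsto_gaussianPDFReal_cocompact μ hv).const_mul K
    rw [mul_zero] at h
    refine squeeze_zero_norm (fun t => ?_) h
    rw [norm_mul, Real.norm_eq_abs, Real.norm_of_nonneg (gaussianPDFReal_nonneg μ v t)]
    exact mul_le_mul_of_nonneg_right (hK t) (gaussianPDFReal_nonneg μ v t)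
  rw [cocompact_eq_atBot_atTop, tendsto_sup] at hlim
  -- Since `φ' = -((t - μ) / v) φ`, the product `f φ` is a primitive of this integrand off `s`. As
  -- `R → ∞` the boundary terms vanish because `f` is bounded.
  have hftc : ∀ R : ℝ, ∫ t in (-R)..R, (f' t * φ t - (v : ℝ)⁻¹ * (f t * (φ t * (t - μ)))) =
      f R * φ R - f (-R) * φ (-R) := by
    intro R
    refine integral_eq_of_hasDerivAt_off_countable (fun t => f t * φ t) _ hs
      (hf.mul hφc).continuousOn (fun t ht => ?_) hint.intervalIntegrable
    refine ((hd t ht.2).mul (hasDerivAt_gaussianPDFReal μ v t)).congr_deriv ?_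
    rw [← hφ]
    field_simp
    ring
  have hl1 := intervalIntegral_tendsto_integral hint tendsto_neg_atTop_atBot tendsto_id
  have hl2 : Tendsto (fun R => f R * φ R - f (-R) * φ (-R)) atTop (𝓝 (0 - 0)) :=
    hlim.2.sub (hlim.1.comp tendsto_neg_atTop_atBot)
  simp only [id, hftc] at hl1
  have h0 := tendsto_nhds_unique hl1 hl2
  rw [integral_sub hi1 (hi2.const_mul _), integral_const_mul, sub_self, sub_eq_zero] at h0
  rw [integral_gaussianReal_eq_integral_smul hv, integral_gaussianReal_eq_integral_smul hv]
  simp only [smul_eq_mul]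
  rw [← hφ]
  have e1 : ∀ t, φ t * ((t - μ) * f t) = f t * (φ t * (t - μ)) := fun t => by ring
  have e2 : ∀ t, φ t * f' t = f' t * φ t := fun t => by ring
  simp_rw [e1, e2]
  rw [h0]
  field_simp

/-- Resampling one coordinate preserves a product law. -/
theorem measurePreserving_update {n : ℕ} {α : Type*} [MeasurableSpace α] (μ : Fin n → Measure α)
    [∀ i, IsProbabilityMeasure (μ i)] (i : Fin n) :
    MeasurePreserving (fun p : (Fin n → α) × α => Function.update p.1 i p.2)
      ((Measure.pi μ).prod (μ i)) (Measure.pi μ) := by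
  have hm : Measurable fun p : (Fin n → α) × α => Function.update p.1 i p.2 := by
    refine measurable_pi_lambda _ fun j => ?_
    by_cases hj : j = i
    · subst hj; simpa using measurable_snd
    · simpa [hj] using (by fun_prop : Measurable fun c : (Fin n → α) × α => c.1 j)
  refine ⟨hm, (Measure.pi_eq fun s hs => ?_).symm⟩
  have hpre : (fun p : (Fin n → α) × α => Function.update p.1 i p.2) ⁻¹' Set.univ.pi s =
      (Set.univ.pi (Function.update s i Set.univ)) ×ˢ s i := by
    ext p
    simp only [Set.mem_preimage, Set.mem_univ_pi, Set.mem_prod]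
    constructor
    · refine fun h => ⟨fun j => ?_, by simpa using h i⟩
      by_cases hj : j = i
      · subst hj; simp
      · simpa [hj] using h j
    · rintro ⟨h, h'⟩ j
      by_cases hj : j = i
      · subst hj; simpa using h'
      · simpa [hj] using h j
  rw [Measure.map_apply hm (.univ_pi hs), hpre, Measure.prod_prod, Measure.pi_pi,
    ← Finset.mul_prod_erase _ _ (Finset.mem_univ i),
    ← Finset.mul_prod_erase Finset.univ (fun j => μ j (s j)) (Finset.mem_univ i)]
  simp only [Function.update_self, measure_univ, one_mul]
  rw [mul_comm]
  congr 1
  exact Finset.prod_congr rfl fun j hj => by rw [Function.update_of_ne (Finset.ne_of_mem_erase hj)]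

/-- **Stein's identity** in one coordinate of a Gaussian vector with independent components. -/
theorem integral_sub_mul_gaussModel {n : ℕ} (V θ : Fin n → ℝ) (i : Fin n) (hV : 0 < V i)
    {g g' : (Fin n → ℝ) → ℝ} (hg : Continuous g) (hg' : Measurable g') {K K' : ℝ}
    (hK : ∀ x, |g x| ≤ K) (hK' : ∀ x, |g' x| ≤ K') (s : (Fin n → ℝ) → Set ℝ)
    (hs : ∀ x, (s x).Countable)
    (hd : ∀ x, ∀ t ∉ s x, HasDerivAt (fun u => g (Function.update x i u))
      (g' (Function.update x i t)) t) :
    ∫ x, (x i - θ i) * g x ∂gaussModel V θ = V i * ∫ x, g' x ∂gaussModel V θ := by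
  rw [gaussModel_apply]
  set μ : Fin n → Measure ℝ := fun i => gaussianReal (θ i) (V i).toNNReal with hμ
  have hmp := measurePreserving_update μ i
  have hupd : ∀ x : Fin n → ℝ, Continuous fun t => Function.update x i t := fun x =>
    continuous_const.update i continuous_id
  have hi1 : Integrable (fun x => (x i - θ i) * g x) (Measure.pi μ) := by
    have h1 : Integrable (fun x : Fin n → ℝ => x i - θ i) (Measure.pi μ) :=
      (integrable_comp_eval (μ := μ) (i := i) (f := fun t => t - θ i)
        (((memLp_id_gaussianReal 1).integrable (by norm_num)).sub (integrable_const _)))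
    simpa only [mul_comm] using h1.bdd_mul (c := K) hg.aestronglyMeasurable (ae_of_all _ hK)
  have hi2 : Integrable g' (Measure.pi μ) :=
    .of_bound hg'.aestronglyMeasurable K' (ae_of_all _ hK')
  have hj1 : Integrable (fun p : (Fin n → ℝ) × ℝ => (Function.update p.1 i p.2 i - θ i) *
      g (Function.update p.1 i p.2)) ((Measure.pi μ).prod (μ i)) :=
    hmp.integrable_comp_of_integrable hi1
  have hj2 : Integrable (fun p : (Fin n → ℝ) × ℝ => g' (Function.update p.1 i p.2))
      ((Measure.pi μ).prod (μ i)) :=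
    hmp.integrable_comp_of_integrable hi2
  -- Resampling coordinate `i` turns each integral into an iterated one whose inner integral is
  -- one-dimensional, with the other coordinates frozen.
  rw [← hmp.map_eq, integral_map hmp.measurable.aemeasurable
      (by rw [hmp.map_eq]; exact hi1.aestronglyMeasurable),
    integral_map hmp.measurable.aemeasurable (by rw [hmp.map_eq]; exact hi2.aestronglyMeasurable),
    integral_prod _ hj1, integral_prod _ hj2, ← integral_const_mul]
  refine integral_congr_ae (ae_of_all _ fun x => ?_)
  have h := integral_sub_mul_gaussianReal (θ i) (v := (V i).toNNReal)
    (by simpa using hV) (hs x) (hg.comp (hupd x)) (hd x) (hg'.comp (hupd x).measurable)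
    (fun t => hK _) (fun t => hK' _)
  simpa [Real.coe_toNNReal _ hV.le] using h

/-! ### Shrinkage towards the mean of a group -/

/-- The mean of `x` over the group `I`. -/
def groupMean {n : ℕ} (I : Finset (Fin n)) (x : Fin n → ℝ) : ℝ :=
  (∑ i ∈ I, x i) / (I.card : ℝ)

/-- The sum of squared deviations from the mean over the group `I`. -/
def groupSS {n : ℕ} (I : Finset (Fin n)) (x : Fin n → ℝ) : ℝ :=
  ∑ i ∈ I, (x i - groupMean I x) ^ 2

/-- The correction `min (1, E / S) (x_i - x̄)`, where `S` is the sum of squared deviations. -/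
def shrinkTerm {n : ℕ} (I : Finset (Fin n)) (E : ℝ) (x : Fin n → ℝ) (i : Fin n) : ℝ :=
  E * (x i - groupMean I x) / max (groupSS I x) E

/-- The derivative of `shrinkTerm I E x i` with respect to `x_i`. -/
def shrinkTermDeriv {n : ℕ} (I : Finset (Fin n)) (E : ℝ) (x : Fin n → ℝ) (i : Fin n) : ℝ :=
  if groupSS I x ≤ E then 1 - 1 / (I.card : ℝ)
  else E * (1 - 1 / (I.card : ℝ)) / groupSS I x -
    2 * E * (x i - groupMean I x) ^ 2 / groupSS I x ^ 2

section Group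

variable {n : ℕ} {I : Finset (Fin n)} {E : ℝ}

theorem continuous_groupMean : Continuous (groupMean I) := by
  unfold groupMean; fun_prop

theorem continuous_groupSS : Continuous (groupSS I) := by
  have := continuous_groupMean (I := I)
  unfold groupSS; fun_prop

theorem groupSS_nonneg (x : Fin n → ℝ) : 0 ≤ groupSS I x :=
  Finset.sum_nonneg fun _ _ => sq_nonneg _

theorem sq_sub_groupMean_le (x : Fin n → ℝ) {i : Fin n} (hi : i ∈ I) :
    (x i - groupMean I x) ^ 2 ≤ groupSS I x :=
  Finset.single_le_sum (f := fun i => (x i - groupMean I x) ^ 2) (fun _ _ => sq_nonneg _) hi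

/-- In this form a change of one coordinate affects only two sums, which makes `groupSS_update` an
explicit quadratic. -/
theorem groupSS_eq (x : Fin n → ℝ) :
    groupSS I x = ∑ i ∈ I, x i ^ 2 - (∑ i ∈ I, x i) ^ 2 / (I.card : ℝ) := by
  rcases I.eq_empty_or_nonempty with rfl | hI
  · simp [groupSS]
  have hc : (I.card : ℝ) ≠ 0 := by exact_mod_cast hI.card_ne_zero
  have h : groupSS I x = ∑ i ∈ I, x i ^ 2 - 2 * groupMean I x * ∑ i ∈ I, x i +
      I.card * groupMean I x ^ 2 := by
    rw [groupSS, Finset.mul_sum, ← nsmul_eq_mul, ← Finset.sum_const, ← Finset.sum_sub_distrib,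
      ← Finset.sum_add_distrib]
    exact Finset.sum_congr rfl fun i _ => by ring
  rw [h, groupMean]
  field_simp
  ring

/-- The sum of squared deviations is smallest around the mean. -/
theorem groupSS_le (x : Fin n → ℝ) (t : ℝ) : groupSS I x ≤ ∑ i ∈ I, (x i - t) ^ 2 := by
  rcases I.eq_empty_or_nonempty with rfl | hI
  · simp [groupSS]
  have hc : (I.card : ℝ) ≠ 0 := by exact_mod_cast hI.card_ne_zero
  have h : ∑ i ∈ I, (x i - t) ^ 2 = groupSS I x + I.card * (groupMean I x - t) ^ 2 := by
    have h1 : ∑ i ∈ I, (x i - t) ^ 2 = ∑ i ∈ I, x i ^ 2 - 2 * t * ∑ i ∈ I, x i +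
        I.card * t ^ 2 := by
      rw [Finset.mul_sum, ← nsmul_eq_mul, ← Finset.sum_const, ← Finset.sum_sub_distrib,
        ← Finset.sum_add_distrib]
      exact Finset.sum_congr rfl fun i _ => by ring
    rw [h1, groupSS_eq, groupMean]
    field_simp
    ring
  rw [h]
  have : 0 ≤ (I.card : ℝ) * (groupMean I x - t) ^ 2 := by positivity
  linarith

theorem sum_update_of_mem_group {i : Fin n} (hi : i ∈ I) (x : Fin n → ℝ) (t : ℝ) (f : ℝ → ℝ) :
    ∑ j ∈ I, f (Function.update x i t j) = ∑ j ∈ I, f (x j) + (f t - f (x i)) := by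
  rw [← Finset.add_sum_erase _ _ hi, ← Finset.add_sum_erase I (fun j => f (x j)) hi,
    Function.update_self, Finset.sum_congr rfl fun j hj => by
      rw [Function.update_of_ne (Finset.ne_of_mem_erase hj)]]
  ring

theorem groupMean_update {i : Fin n} (hi : i ∈ I) (x : Fin n → ℝ) (t : ℝ) :
    groupMean I (Function.update x i t) = groupMean I x + (t - x i) / I.card := by
  rw [groupMean, sum_update_of_mem_group hi x t fun u => u, groupMean, add_div]

theorem groupSS_update {i : Fin n} (hi : i ∈ I) (x : Fin n → ℝ) (t : ℝ) :
    groupSS I (Function.update x i t) = groupSS I x + 2 * (x i - groupMean I x) * (t - x i) +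
      (1 - 1 / (I.card : ℝ)) * (t - x i) ^ 2 := by
  have hc : (I.card : ℝ) ≠ 0 := by exact_mod_cast Finset.card_ne_zero_of_mem hi
  rw [groupSS_eq, sum_update_of_mem_group hi x t fun u => u,
    sum_update_of_mem_group hi x t fun u => u ^ 2, groupSS_eq, groupMean]
  field_simp
  ring

theorem hasDerivAt_sub_groupMean_update {i : Fin n} (hi : i ∈ I) (x : Fin n → ℝ) (t : ℝ) :
    HasDerivAt (fun u => Function.update x i u i - groupMean I (Function.update x i u))
      (1 - 1 / (I.card : ℝ)) t := by
  simp only [groupMean_update hi, Function.update_self]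
  exact (hasDerivAt_id t).sub ((((hasDerivAt_id t).sub_const (x i)).div_const _).const_add _)

theorem hasDerivAt_groupSS_update {i : Fin n} (hi : i ∈ I) (x : Fin n → ℝ) (t : ℝ) :
    HasDerivAt (fun u => groupSS I (Function.update x i u))
      (2 * (Function.update x i t i - groupMean I (Function.update x i t))) t := by
  simp only [groupSS_update hi, groupMean_update hi, Function.update_self]
  have h := (((hasDerivAt_id t).sub_const (x i)).const_mul
    (2 * (x i - groupMean I x))).const_add (groupSS I x)
  have h' := (((hasDerivAt_id t).sub_const (x i)).pow 2).const_mul (1 - 1 / (I.card : ℝ))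
  refine (h.add h').congr_deriv ?_
  simp
  ring

/-- In one coordinate the sum of squares is a quadratic polynomial with leading coefficient `1 - 1 /
|I|`, nonzero once `|I| ≥ 2`, so a level set has at most two points. -/
theorem countable_groupSS_update_eq (hI : 2 ≤ I.card) {i : Fin n} (hi : i ∈ I) (x : Fin n → ℝ)
    (E : ℝ) : {t | groupSS I (Function.update x i t) = E}.Countable := by
  have hα : 1 - 1 / (I.card : ℝ) ≠ 0 := by
    have : (2 : ℝ) ≤ I.card := by exact_mod_cast hI
    have : 1 / (I.card : ℝ) ≤ 1 / 2 := one_div_le_one_div_of_le (by norm_num) this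
    linarith
  rcases Set.eq_empty_or_nonempty {t | groupSS I (Function.update x i t) = E} with h | ⟨s, hs⟩
  · rw [h]; exact Set.countable_empty
  -- Given one root `s`, the other is found from the sum of the roots.
  refine Set.Countable.mono (s₂ := {s, 2 * x i -
    2 * (x i - groupMean I x) / (1 - 1 / (I.card : ℝ)) - s}) (fun t ht => ?_)
    (Set.toFinite _).countable
  simp only [Set.mem_ofPred_eq, groupSS_update hi] at hs ht
  have hst : (t - s) * (2 * (x i - groupMean I x) +
      (1 - 1 / (I.card : ℝ)) * (t + s - 2 * x i)) = 0 := by linear_combination ht - hs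
  rcases mul_eq_zero.1 hst with h | h
  · exact Or.inl (by linarith)
  · refine Or.inr ?_
    have h' : 2 * (x i - groupMean I x) / (1 - 1 / (I.card : ℝ)) = 2 * x i - t - s := by
      rw [div_eq_iff hα]; linarith
    rw [Set.mem_singleton_iff, h']
    ring

/-- Writing `min (1, E / S)` as `E / max S E` keeps the denominator at least `E > 0`, so there is no
singularity at `S = 0`. -/
theorem continuous_shrinkTerm (hE : 0 < E) (i : Fin n) :
    Continuous fun x => shrinkTerm I E x i := by
  have h1 := continuous_groupMean (I := I)
  have h2 := continuous_groupSS (I := I)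
  unfold shrinkTerm
  exact Continuous.div (by fun_prop) (by fun_prop) fun x => (lt_max_of_lt_right hE).ne'

theorem measurable_shrinkTermDeriv (i : Fin n) :
    Measurable fun x => shrinkTermDeriv I E x i := by
  have h1 := (continuous_groupMean (I := I)).measurable
  have h2 := (continuous_groupSS (I := I)).measurable
  unfold shrinkTermDeriv
  exact Measurable.ite (measurableSet_le h2 measurable_const) measurable_const (by fun_prop)

/-- Away from `S = E`, the maximum in the denominator is locally one fixed argument. -/
theorem hasDerivAt_shrinkTerm (hE : 0 < E) {i : Fin n} (hi : i ∈ I) (x : Fin n → ℝ) {t : ℝ}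
    (ht : groupSS I (Function.update x i t) ≠ E) :
    HasDerivAt (fun u => shrinkTerm I E (Function.update x i u) i)
      (shrinkTermDeriv I E (Function.update x i t) i) t := by
  have hD := hasDerivAt_sub_groupMean_update hi x t
  have hS := hasDerivAt_groupSS_update hi x t
  rcases ht.lt_or_gt with h | h
  · rw [shrinkTermDeriv, if_pos h.le]
    refine hD.congr_of_eventuallyEq ?_
    filter_upwards [hS.continuousAt.eventually_lt continuousAt_const h] with u hu
    rw [shrinkTerm, max_eq_right hu.le, mul_div_cancel_left₀ _ hE.ne']
  · rw [shrinkTermDeriv, if_neg h.not_ge]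
    have hpos : groupSS I (Function.update x i t) ≠ 0 := (hE.trans h).ne'
    refine ((hD.const_mul E).div hS hpos).congr_of_eventuallyEq ?_ |>.congr_deriv ?_
    · filter_upwards [continuousAt_const.eventually_lt hS.continuousAt h] with u hu
      rw [shrinkTerm, max_eq_left hu.le]
      rfl
    · field_simp

/-- With `X = max S E`, the square is at most `E² S / X² ≤ E² / X ≤ E`. -/
theorem abs_shrinkTerm_le (hE : 0 < E) {i : Fin n} (hi : i ∈ I) (x : Fin n → ℝ) :
    |shrinkTerm I E x i| ≤ √E := by
  refine Real.abs_le_sqrt ?_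
  have hX : E ≤ max (groupSS I x) E := le_max_right _ _
  have hD : (x i - groupMean I x) ^ 2 ≤ max (groupSS I x) E :=
    (sq_sub_groupMean_le x hi).trans (le_max_left _ _)
  have hX0 : 0 < max (groupSS I x) E := hE.trans_le hX
  rw [shrinkTerm, div_pow, div_le_iff₀ (by positivity), mul_pow]
  calc E ^ 2 * (x i - groupMean I x) ^ 2 ≤ (E * max (groupSS I x) E) * max (groupSS I x) E := by
        refine mul_le_mul ?_ hD (sq_nonneg _) (by positivity)
        rw [sq]; exact mul_le_mul_of_nonneg_left hX hE.le
    _ = _ := by ring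

/-- Beyond the threshold the derivative is a number in `[0, 1]` minus a number in `[0, 2]`. Only the
existence of a uniform bound matters for Stein's identity. -/
theorem abs_shrinkTermDeriv_le (hE : 0 < E) {i : Fin n} (hi : i ∈ I) (x : Fin n → ℝ) :
    |shrinkTermDeriv I E x i| ≤ 3 := by
  have hc : (1 : ℝ) ≤ I.card := by exact_mod_cast Finset.card_pos.2 ⟨i, hi⟩
  have h1 : 1 / (I.card : ℝ) ≤ 1 := (div_le_one (by linarith)).2 hc
  have h0 : 0 ≤ 1 / (I.card : ℝ) := by positivity
  rw [shrinkTermDeriv]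
  split_ifs with h
  · rw [abs_le]; constructor <;> linarith
  · have hS : E < groupSS I x := not_le.1 h
    have hS0 : 0 < groupSS I x := hE.trans hS
    have hD := sq_sub_groupMean_le x hi
    have a1 : E * (1 - 1 / (I.card : ℝ)) / groupSS I x ≤ 1 := by
      rw [div_le_one hS0]; nlinarith
    have a0 : 0 ≤ E * (1 - 1 / (I.card : ℝ)) / groupSS I x :=
      div_nonneg (mul_nonneg hE.le (by linarith)) hS0.le
    have b1 : 2 * E * (x i - groupMean I x) ^ 2 / groupSS I x ^ 2 ≤ 2 := by
      rw [div_le_iff₀ (by positivity)]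
      have := mul_le_mul hS.le hD (sq_nonneg _) hS0.le
      nlinarith
    have b0 : 0 ≤ 2 * E * (x i - groupMean I x) ^ 2 / groupSS I x ^ 2 := by positivity
    rw [abs_le]; constructor <;> linarith

/-- The unbiased estimate of the risk change is at most that of linear shrinkage by any factor
`q ∈ [0, 1]`. -/
theorem sum_shrinkTerm_le (hE : 0 < E) (V x : Fin n → ℝ) {M q : ℝ}
    (hVM : ∀ i ∈ I, V i ≤ M) (hEW : E ≤ (1 - 1 / (I.card : ℝ)) * ∑ i ∈ I, V i)
    (hM : 2 * M ≤ (1 - 1 / (I.card : ℝ)) * ∑ i ∈ I, V i - E) (hq0 : 0 ≤ q) (hq1 : q ≤ 1) :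
    ∑ i ∈ I, (shrinkTerm I E x i ^ 2 - 2 * (V i * shrinkTermDeriv I E x i)) ≤
      -(2 * E * q) + q ^ 2 * groupSS I x := by
  set α := 1 - 1 / (I.card : ℝ) with hα
  set W := α * ∑ i ∈ I, V i with hW
  set S := groupSS I x with hS
  have hS0 : 0 ≤ S := groupSS_nonneg x
  rcases le_or_gt S E with h | h
  · have e : ∑ i ∈ I, (shrinkTerm I E x i ^ 2 - 2 * (V i * shrinkTermDeriv I E x i)) =
        S - 2 * W := by
      rw [hS, groupSS, hW, Finset.mul_sum, Finset.mul_sum, ← Finset.sum_sub_distrib]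
      refine Finset.sum_congr rfl fun i _ => ?_
      rw [shrinkTermDeriv, if_pos h, shrinkTerm, max_eq_right h, mul_div_cancel_left₀ _ hE.ne']
      ring
    rw [e]
    -- Since `W ≥ E`, it remains to see that `(1 - q²) S ≤ (1 - q²) E ≤ 2 (1 - q) E`.
    nlinarith [mul_nonneg (mul_nonneg (sub_nonneg.2 hq1) (by linarith : 0 ≤ 1 + q))
      (sub_nonneg.2 h), mul_nonneg hE.le (mul_nonneg (sub_nonneg.2 hq1) (sub_nonneg.2 hq1))]
  · have hSpos : 0 < S := hE.trans h
    have e : ∑ i ∈ I, (shrinkTerm I E x i ^ 2 - 2 * (V i * shrinkTermDeriv I E x i)) =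
        E ^ 2 / S - 2 * E * W / S +
          4 * E / S ^ 2 * ∑ i ∈ I, V i * (x i - groupMean I x) ^ 2 := by
      have e1 : E ^ 2 / S = ∑ i ∈ I, E ^ 2 / S ^ 2 * (x i - groupMean I x) ^ 2 := by
        rw [← Finset.mul_sum, ← groupSS, ← hS]; field_simp
      have e2 : 2 * E * W / S = ∑ i ∈ I, 2 * E * α / S * V i := by
        rw [← Finset.mul_sum, hW]; ring
      rw [e1, e2, Finset.mul_sum, ← Finset.sum_sub_distrib, ← Finset.sum_add_distrib]
      refine Finset.sum_congr rfl fun i _ => ?_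
      rw [shrinkTermDeriv, if_neg h.not_ge, shrinkTerm, max_eq_left h.le, ← hS, ← hα]
      field_simp
      ring
    have hsum : ∑ i ∈ I, V i * (x i - groupMean I x) ^ 2 ≤ M * S := by
      rw [hS, groupSS, Finset.mul_sum]
      exact Finset.sum_le_sum fun i hi => mul_le_mul_of_nonneg_right (hVM i hi) (sq_nonneg _)
    have h1 : 4 * E / S ^ 2 * ∑ i ∈ I, V i * (x i - groupMean I x) ^ 2 ≤ 4 * E * M / S := by
      calc _ ≤ 4 * E / S ^ 2 * (M * S) := mul_le_mul_of_nonneg_left hsum (by positivity)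
        _ = _ := by field_simp
    -- The condition `2 M ≤ W - E` enters here: it pays for the derivative of the random factor `E /
    -- S`.
    have h2 : E ^ 2 / S - 2 * E * W / S + 4 * E * M / S ≤ -(E ^ 2 / S) := by
      rw [← sub_nonneg]
      have : -(E ^ 2 / S) - (E ^ 2 / S - 2 * E * W / S + 4 * E * M / S) =
          2 * E * (W - E - 2 * M) / S := by ring
      rw [this]
      exact div_nonneg (mul_nonneg (by positivity) (by linarith)) hS0
    -- The left side is the minimum over `q` of the quadratic on the right, attained at `q = E / S`.
    have h3 : -(E ^ 2 / S) ≤ -(2 * E * q) + q ^ 2 * S := by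
      have : -(2 * E * q) + q ^ 2 * S + E ^ 2 / S = (E - q * S) ^ 2 / S := by
        field_simp; ring
      have h4 : 0 ≤ (E - q * S) ^ 2 / S := by positivity
      linarith
    rw [e]
    linarith

end Group

theorem memLp_eval_gaussModel {n : ℕ} (V θ : Fin n → ℝ) (i : Fin n) :
    MemLp (fun x : Fin n → ℝ => x i) 2 (gaussModel V θ) := by
  have h := (memLp_id_gaussianReal (μ := θ i) (v := (V i).toNNReal) 2).comp_measurePreserving
    (measurePreserving_eval (fun i => gaussianReal (θ i) (V i).toNNReal) i)
  exact h

theorem integrable_eval_gaussModel {n : ℕ} (V θ : Fin n → ℝ) (i : Fin n) :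
    Integrable (fun x : Fin n → ℝ => x i - θ i) (gaussModel V θ) :=
  ((memLp_eval_gaussModel V θ i).integrable (by norm_num)).sub (integrable_const _)

theorem integrable_groupSS {n : ℕ} (I : Finset (Fin n)) (V θ : Fin n → ℝ) :
    Integrable (groupSS I) (gaussModel V θ) := by
  unfold groupSS
  refine integrable_finsetSum _ fun i _ => ?_
  refine ((memLp_eval_gaussModel V θ i).sub ?_).integrable_sq
  unfold groupMean
  simp only [div_eq_inv_mul]
  exact (memLp_finsetSum I fun i _ => memLp_eval_gaussModel V θ i).const_mul _

/-- The change of the risk of a group under shrinkage, compared with linear shrinkage. -/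
theorem integral_shrinkTerm_le {n : ℕ} {I : Finset (Fin n)} {E : ℝ} (hE : 0 < E)
    (hI : 2 ≤ I.card) (V θ : Fin n → ℝ) (hV : ∀ i, 0 < V i) {M q : ℝ}
    (hVM : ∀ i ∈ I, V i ≤ M) (hEW : E ≤ (1 - 1 / (I.card : ℝ)) * ∑ i ∈ I, V i)
    (hM : 2 * M ≤ (1 - 1 / (I.card : ℝ)) * ∑ i ∈ I, V i - E) (hq0 : 0 ≤ q) (hq1 : q ≤ 1) :
    Integrable (fun x => ∑ i ∈ I, (shrinkTerm I E x i ^ 2 -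
      2 * ((x i - θ i) * shrinkTerm I E x i))) (gaussModel V θ) ∧
    ∫ x, ∑ i ∈ I, (shrinkTerm I E x i ^ 2 - 2 * ((x i - θ i) * shrinkTerm I E x i))
      ∂gaussModel V θ ≤ -(2 * E * q) + q ^ 2 * ∫ x, groupSS I x ∂gaussModel V θ := by
  have hg2 : ∀ i ∈ I, Integrable (fun x => shrinkTerm I E x i ^ 2) (gaussModel V θ) :=
    fun i hi => .of_bound ((continuous_shrinkTerm hE i).pow 2).aestronglyMeasurable (√E ^ 2)
      (ae_of_all _ fun x => by
        rw [norm_pow]; exact pow_le_pow_left₀ (norm_nonneg _) (abs_shrinkTerm_le hE hi x) 2)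
  have hxg : ∀ i ∈ I, Integrable (fun x => (x i - θ i) * shrinkTerm I E x i) (gaussModel V θ) :=
    fun i hi => (integrable_eval_gaussModel V θ i).mul_bdd (c := √E)
      (continuous_shrinkTerm hE i).aestronglyMeasurable
      (ae_of_all _ fun x => abs_shrinkTerm_le hE hi x)
  have hg' : ∀ i ∈ I, Integrable (fun x => shrinkTermDeriv I E x i) (gaussModel V θ) :=
    fun i hi => .of_bound (measurable_shrinkTermDeriv i).aestronglyMeasurable 3
      (ae_of_all _ fun x => abs_shrinkTermDeriv_le hE hi x)
  have hterm : ∀ i ∈ I, Integrable (fun x => shrinkTerm I E x i ^ 2 -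
      2 * ((x i - θ i) * shrinkTerm I E x i)) (gaussModel V θ) :=
    fun i hi => (hg2 i hi).sub ((hxg i hi).const_mul 2)
  have hterm' : ∀ i ∈ I, Integrable (fun x => shrinkTerm I E x i ^ 2 -
      2 * (V i * shrinkTermDeriv I E x i)) (gaussModel V θ) :=
    fun i hi => (hg2 i hi).sub (((hg' i hi).const_mul (V i)).const_mul 2)
  refine ⟨integrable_finsetSum _ hterm, ?_⟩
  have hstein : ∀ i ∈ I, ∫ x, (shrinkTerm I E x i ^ 2 -
      2 * ((x i - θ i) * shrinkTerm I E x i)) ∂gaussModel V θ =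
      ∫ x, (shrinkTerm I E x i ^ 2 - 2 * (V i * shrinkTermDeriv I E x i)) ∂gaussModel V θ := by
    intro i hi
    rw [integral_sub (hg2 i hi) ((hxg i hi).const_mul 2),
      integral_sub (hg2 i hi) (((hg' i hi).const_mul (V i)).const_mul 2), integral_const_mul,
      integral_const_mul, integral_const_mul,
      integral_sub_mul_gaussModel V θ i (hV i) (continuous_shrinkTerm hE i)
        (measurable_shrinkTermDeriv i) (abs_shrinkTerm_le hE hi) (abs_shrinkTermDeriv_le hE hi)
        (fun x => {t | groupSS I (Function.update x i t) = E})
        (fun x => countable_groupSS_update_eq hI hi x E)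
        (fun x t ht => hasDerivAt_shrinkTerm hE hi x ht)]
  rw [integral_finsetSum _ hterm, Finset.sum_congr rfl hstein, ← integral_finsetSum _ hterm']
  have hSS := integrable_groupSS I V θ
  calc _ ≤ ∫ x, (-(2 * E * q) + q ^ 2 * groupSS I x) ∂gaussModel V θ :=
        integral_mono (integrable_finsetSum _ hterm') ((integrable_const _).add (hSS.const_mul _))
          fun x => sum_shrinkTerm_le hE V x hVM hEW hM hq0 hq1
    _ = _ := by
      rw [integral_add (integrable_const _) (hSS.const_mul _), integral_const_mul]
      simp

/-! ### Risk of the group-linear estimator -/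

section Bins

variable {n m : ℕ} {J : Fin m → Set ℝ} {V : Fin n → ℝ}

theorem mem_binIdx {k : Fin m} {i : Fin n} : i ∈ binIdx J V k ↔ V i ∈ J k := by
  simp [binIdx]

theorem binMean_eq (x : Fin n → ℝ) (k : Fin m) :
    binMean J V x k = groupMean (binIdx J V k) x := rfl

/-- The threshold `(n_k - 1) c_k V̄_k` for the sum of squared deviations of a bin. -/
def binThreshold (J : Fin m → Set ℝ) (V : Fin n → ℝ) (k : Fin m) : ℝ :=
  ((binSize J V k : ℝ) - 1) * shrinkConst J V k * binMean J V V k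

theorem shrinkConst_nonneg (k : Fin m) : 0 ≤ shrinkConst J V k := le_max_right _ _

theorem binMean_nonneg (hV : ∀ i, 0 < V i) (k : Fin m) : 0 ≤ binMean J V V k :=
  div_nonneg (Finset.sum_nonneg fun i _ => (hV i).le) (Nat.cast_nonneg _)

theorem binMean_pos (hV : ∀ i, 0 < V i) {k : Fin m} (hk : 0 < binSize J V k) :
    0 < binMean J V V k :=
  div_pos (Finset.sum_pos (fun i _ => hV i) (Finset.card_pos.1 hk)) (Nat.cast_pos.2 hk)

theorem le_binMax {k : Fin m} {i : Fin n} (hi : i ∈ binIdx J V k) : V i ≤ binMax J V k :=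
  le_csSup (Set.toFinite _).bddAbove ⟨i, hi, rfl⟩

theorem binMax_le {k : Fin m} (hk : 0 < binSize J V k) {M : ℝ}
    (hM : ∀ i ∈ binIdx J V k, V i ≤ M) : binMax J V k ≤ M := by
  obtain ⟨i, hi⟩ := Finset.card_pos.1 hk
  refine csSup_le ⟨V i, i, hi, rfl⟩ ?_
  rintro _ ⟨j, hj, rfl⟩
  exact hM j hj

theorem binMax_nonneg (hV : ∀ i, 0 < V i) (k : Fin m) : 0 ≤ binMax J V k :=
  Real.sSup_nonneg (by rintro _ ⟨j, _, rfl⟩; exact (hV j).le)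

theorem shrinkConst_le_one (hV : ∀ i, 0 < V i) {k : Fin m} (hk : 1 ≤ binSize J V k) :
    shrinkConst J V k ≤ 1 := by
  refine max_le ?_ zero_le_one
  have h : (1 : ℝ) ≤ binSize J V k := by exact_mod_cast hk
  have : 0 ≤ 2 * (binMax J V k / binMean J V V k) / ((binSize J V k : ℝ) - 1) :=
    div_nonneg (mul_nonneg zero_le_two (div_nonneg (binMax_nonneg hV k) (binMean_nonneg hV k)))
      (by linarith)
  linarith

theorem binThreshold_nonneg (hV : ∀ i, 0 < V i) (k : Fin m) : 0 ≤ binThreshold J V k := by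
  rcases Nat.eq_zero_or_pos (binSize J V k) with h | h
  · simp [binThreshold, binMean, h]
  · have h : (1 : ℝ) ≤ binSize J V k := by exact_mod_cast h
    exact mul_nonneg (mul_nonneg (by linarith) (shrinkConst_nonneg k)) (binMean_nonneg hV k)

/-- For `n_k ≥ 2` one has `S = (n_k - 1) s_k²`, so `c_k V̄_k / s_k²` equals `E / S`. If `n_k = 1` or
`S = 0`, the deviation vanishes, and default values of divisions by zero do no harm. -/
theorem shrinkFactor_mul (hV : ∀ i, 0 < V i) (x : Fin n → ℝ) {k : Fin m} {i : Fin n}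
    (hi : i ∈ binIdx J V k) :
    shrinkFactor J V x k * (x i - binMean J V x k) =
      shrinkTerm (binIdx J V k) (binThreshold J V k) x i := by
  rw [binMean_eq, shrinkTerm]
  by_cases hD : x i - groupMean (binIdx J V k) x = 0
  · simp [hD]
  have hSpos : 0 < groupSS (binIdx J V k) x :=
    (by positivity : 0 < (x i - groupMean (binIdx J V k) x) ^ 2).trans_le (sq_sub_groupMean_le x hi)
  have hk2 : 2 ≤ binSize J V k := by
    by_contra! h
    have h1 : (binIdx J V k).card = 1 := by
      have := Finset.card_pos.2 ⟨i, hi⟩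
      unfold binSize at h
      omega
    obtain ⟨a, ha⟩ := Finset.card_eq_one.1 h1
    rw [ha, Finset.mem_singleton] at hi
    subst hi
    simp [ha, groupMean] at hD
  have hk2' : (2 : ℝ) ≤ binSize J V k := by exact_mod_cast hk2
  have hr : (0 : ℝ) < binSize J V k - 1 := by linarith
  have hE := binThreshold_nonneg (J := J) hV k
  have hratio : shrinkConst J V k * binMean J V V k / binVar J V x k =
      binThreshold J V k / groupSS (binIdx J V k) x := by
    have : binVar J V x k = groupSS (binIdx J V k) x / ((binSize J V k : ℝ) - 1) := by
      rw [binVar, max_eq_left hk2']; rfl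
    rw [this, binThreshold]
    field_simp
  rw [shrinkFactor, hratio]
  rcases le_or_gt (binThreshold J V k) (groupSS (binIdx J V k) x) with h | h
  · rw [min_eq_right ((div_le_one hSpos).2 h), max_eq_left h]; ring
  · rw [min_eq_left ((one_le_div hSpos).2 h.le), max_eq_right h.le,
      mul_div_cancel_left₀ _ (hSpos.trans h).ne', one_mul]

/-- The squared error of the group-linear estimator, bin by bin. -/
theorem sum_sq_glEstimator (hJ : IsBinning J) (hV : ∀ i, 0 < V i) (θ x : Fin n → ℝ) :
    ∑ i, (glEstimator J V x i - θ i) ^ 2 = ∑ i, (x i - θ i) ^ 2 +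
      ∑ k, ∑ i ∈ binIdx J V k, (shrinkTerm (binIdx J V k) (binThreshold J V k) x i ^ 2 -
        2 * ((x i - θ i) * shrinkTerm (binIdx J V k) (binThreshold J V k) x i)) := by
  classical
  have hcomm : ∀ f : Fin m → Fin n → ℝ, ∑ k, ∑ i ∈ binIdx J V k, f k i =
      ∑ i, ∑ k, if i ∈ binIdx J V k then f k i else 0 := by
    intro f
    rw [Finset.sum_comm]
    exact Finset.sum_congr rfl fun k _ => by simp
  rw [hcomm, ← Finset.sum_add_distrib]
  refine Finset.sum_congr rfl fun i _ => ?_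
  unfold glEstimator
  by_cases hi : ∃ k, i ∈ binIdx J V k
  · obtain ⟨k, hk⟩ := hi
    have hne : ∀ l, l ≠ k → i ∉ binIdx J V l := fun l hl hil =>
      Set.disjoint_left.1 (hJ.disjoint hl) (mem_binIdx.1 hil) (mem_binIdx.1 hk)
    rw [Fintype.sum_eq_single k fun l hl => if_neg (hne l hl),
      Fintype.sum_eq_single k fun l hl => if_neg (hne l hl), if_pos hk, if_pos hk,
      shrinkFactor_mul hV x hk]
    ring
  · simp only [not_exists] at hi
    simp [hi]

theorem measurable_shrinkFactor (k : Fin m) : Measurable fun x => shrinkFactor J V x k := by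
  unfold shrinkFactor binVar binMean; fun_prop

theorem measurable_glEstimator : Measurable (glEstimator J V) := by
  refine measurable_pi_lambda _ fun i => ?_
  unfold glEstimator
  refine (measurable_pi_apply i).sub (Finset.measurable_sum _ fun k _ => ?_)
  split_ifs
  · exact (measurable_shrinkFactor k).mul (by unfold binMean; fun_prop)
  · exact measurable_const

theorem measurable_loss {n : ℕ} :
    Measurable fun p : (Fin n → ℝ) × (Fin n → ℝ) => loss p.1 p.2 := by
  unfold loss; fun_prop

theorem measurable_loss_right {n : ℕ} (θ : Fin n → ℝ) : Measurable (loss θ) := by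
  unfold loss; fun_prop

end Bins

/-! ### Second moments and risk bounds for fixed means. -/

theorem integral_affine_sq_gaussianReal (μ : ℝ) (v : ℝ≥0) (c d : ℝ) :
    Integrable (fun t => (c * t + d) ^ 2) (gaussianReal μ v) ∧
      ∫ t, (c * t + d) ^ 2 ∂gaussianReal μ v = c ^ 2 * v + (c * μ + d) ^ 2 := by
  have hid : MemLp (fun t : ℝ => t) 2 (gaussianReal μ v) := memLp_id_gaussianReal 2
  have hX : MemLp (fun t => c * t + d) 2 (gaussianReal μ v) :=
    (hid.const_mul c).add (memLp_const d)
  refine ⟨hX.integrable_sq, ?_⟩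
  have hvar := variance_eq_sub hX
  have hmean : ∫ t, (c * t + d) ∂gaussianReal μ v = c * μ + d := by
    rw [integral_add ((hid.integrable (by norm_num)).const_mul c) (integrable_const d),
      integral_const_mul, integral_id_gaussianReal]
    simp
  have hvar' : Var[fun t => c * t + d; gaussianReal μ v] = c ^ 2 * v := by
    rw [variance_add_const (by fun_prop), variance_const_mul, variance_fun_id_gaussianReal]
  rw [hvar', hmean] at hvar
  simp only [Pi.pow_apply] at hvar
  linarith

theorem lintegral_affine_sq_gaussianReal (μ : ℝ) (v : ℝ≥0) (c d : ℝ) :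
    ∫⁻ t, ENNReal.ofReal ((c * t + d) ^ 2) ∂gaussianReal μ v =
      ENNReal.ofReal (c ^ 2 * v + (c * μ + d) ^ 2) := by
  obtain ⟨h1, h2⟩ := integral_affine_sq_gaussianReal μ v c d
  rw [← ofReal_integral_eq_lintegral_ofReal h1 (ae_of_all _ fun _ => sq_nonneg _), h2]

theorem integral_sum_sq_gaussModel {n : ℕ} {V : Fin n → ℝ} (hV : ∀ i, 0 < V i) (θ y : Fin n → ℝ) :
    Integrable (fun x => ∑ i, (x i - y i) ^ 2) (gaussModel V θ) ∧
      ∫ x, ∑ i, (x i - y i) ^ 2 ∂gaussModel V θ = ∑ i, (V i + (θ i - y i) ^ 2) := by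
  have hi : ∀ i, Integrable (fun x : Fin n → ℝ => (x i - y i) ^ 2) (gaussModel V θ) := fun i =>
    ((memLp_eval_gaussModel V θ i).sub (memLp_const _)).integrable_sq
  refine ⟨integrable_finsetSum _ fun i _ => hi i, ?_⟩
  rw [integral_finsetSum _ fun i _ => hi i]
  refine Finset.sum_congr rfl fun i _ => ?_
  obtain ⟨h1, h2⟩ := integral_affine_sq_gaussianReal (θ i) (V i).toNNReal 1 (-y i)
  have h3 := (measurePreserving_eval (fun i => gaussianReal (θ i) (V i).toNNReal) i).map_eq
  have h4 := integral_map (μ := gaussModel V θ) (measurable_pi_apply i).aemeasurable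
    (f := fun t => (1 * t + -y i) ^ 2) (by fun_prop)
  rw [gaussModel_apply] at h4 ⊢
  rw [h3, h2] at h4
  simp only [one_mul, one_pow, ← sub_eq_add_neg, Real.coe_toNNReal _ (hV i).le] at h4
  exact h4.symm

theorem risk_id {n : ℕ} {V : Fin n → ℝ} (hV : ∀ i, 0 < V i) (θ : Fin n → ℝ) :
    risk V θ (fun x => x) = ENNReal.ofReal ((∑ i, V i) / (n : ℝ)) := by
  obtain ⟨h1, h2⟩ := integral_sum_sq_gaussModel hV θ θ
  unfold risk loss
  rw [← ofReal_integral_eq_lintegral_ofReal (h1.div_const _) (ae_of_all _ fun x => by positivity),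
    integral_div, h2]
  simp

/-- The total squared error of the group-linear estimator is at most the one obtained when each bin
is shrunk linearly by the factor `q_k`, up to the loss in the constants `c_k`. -/
theorem integral_sum_sq_glEstimator_le {n m : ℕ} {J : Fin m → Set ℝ} {V : Fin n → ℝ}
    (hJ : IsBinning J) (hV : ∀ i, 0 < V i) (θ : Fin n → ℝ) {q : Fin m → ℝ}
    (hq0 : ∀ k, 0 ≤ q k) (hq1 : ∀ k, q k ≤ 1) :
    Integrable (fun x => ∑ i, (glEstimator J V x i - θ i) ^ 2) (gaussModel V θ) ∧
    ∫ x, ∑ i, (glEstimator J V x i - θ i) ^ 2 ∂gaussModel V θ ≤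
      ∑ i, V i + ∑ k, (-(2 * binThreshold J V k * q k) +
        q k ^ 2 * ∫ x, groupSS (binIdx J V k) x ∂gaussModel V θ) := by
  obtain ⟨h1, h2⟩ := integral_sum_sq_gaussModel hV θ θ
  have hbin : ∀ k, Integrable (fun x => ∑ i ∈ binIdx J V k,
      (shrinkTerm (binIdx J V k) (binThreshold J V k) x i ^ 2 -
        2 * ((x i - θ i) * shrinkTerm (binIdx J V k) (binThreshold J V k) x i)))
        (gaussModel V θ) ∧
      ∫ x, ∑ i ∈ binIdx J V k, (shrinkTerm (binIdx J V k) (binThreshold J V k) x i ^ 2 -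
        2 * ((x i - θ i) * shrinkTerm (binIdx J V k) (binThreshold J V k) x i))
        ∂gaussModel V θ ≤ -(2 * binThreshold J V k * q k) +
        q k ^ 2 * ∫ x, groupSS (binIdx J V k) x ∂gaussModel V θ := by
    intro k
    -- With threshold zero nothing is subtracted, and the claimed bound is a nonnegative number.
    rcases (binThreshold_nonneg (J := J) hV k).eq_or_lt with h0 | hE
    · rw [← h0]
      have : 0 ≤ q k ^ 2 * ∫ x, groupSS (binIdx J V k) x ∂gaussModel V θ :=
        mul_nonneg (sq_nonneg _) (integral_nonneg groupSS_nonneg)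
      simpa [shrinkTerm] using this
    have hk : 2 ≤ binSize J V k := by
      by_contra! h
      interval_cases hb : binSize J V k
      · simp [binThreshold, binMean, hb] at hE
      · simp [binThreshold, hb] at hE
    have hk' : (2 : ℝ) ≤ binSize J V k := by exact_mod_cast hk
    have hr : (0 : ℝ) < binSize J V k - 1 := by linarith
    have hm := binMean_pos (J := J) hV (by omega : 0 < binSize J V k)
    have hW : (1 - 1 / ((binIdx J V k).card : ℝ)) * ∑ i ∈ binIdx J V k, V i =
        ((binSize J V k : ℝ) - 1) * binMean J V V k := by
      have : (binSize J V k : ℝ) ≠ 0 := by linarith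
      rw [binMean]
      change (1 - 1 / (binSize J V k : ℝ)) * _ = _
      field_simp
    -- A positive threshold means that the positive part in `c_k` is inactive.
    have hc : shrinkConst J V k =
        1 - 2 * (binMax J V k / binMean J V V k) / ((binSize J V k : ℝ) - 1) := by
      refine max_eq_left_of_lt (lt_of_not_ge fun h => ?_)
      rw [binThreshold, shrinkConst, max_eq_right h] at hE
      simp at hE
    refine integral_shrinkTerm_le hE hk V θ hV (M := binMax J V k) (fun i hi => le_binMax hi)
      ?_ ?_ (hq0 k) (hq1 k)
    · rw [hW, binThreshold]
      have := shrinkConst_le_one (J := J) hV (by omega : 1 ≤ binSize J V k)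
      exact mul_le_mul_of_nonneg_right (by nlinarith) hm.le
    -- Equality holds: `(n_k - 1) V̄_k - E = 2 max V_i`. This accounts for the constant in `c_k`.
    · rw [hW, binThreshold, hc]
      refine le_of_eq ?_
      field_simp
      ring
  simp_rw [sum_sq_glEstimator hJ hV]
  have hsum := integrable_finsetSum Finset.univ fun k _ => (hbin k).1
  refine ⟨h1.add hsum, ?_⟩
  rw [integral_add h1 hsum, h2, integral_finsetSum _ fun k _ => (hbin k).1]
  simp only [sub_self, ne_eq, OfNat.ofNat_ne_zero, not_false_eq_true, zero_pow, add_zero]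
  gcongr with k
  exact (hbin k).2

theorem risk_glEstimator_eq {n m : ℕ} {J : Fin m → Set ℝ} {V : Fin n → ℝ}
    (hJ : IsBinning J) (hV : ∀ i, 0 < V i) (θ : Fin n → ℝ) :
    risk V θ (glEstimator J V) = ENNReal.ofReal
      ((∫ x, ∑ i, (glEstimator J V x i - θ i) ^ 2 ∂gaussModel V θ) / (n : ℝ)) := by
  have h1 := (integral_sum_sq_glEstimator_le hJ hV θ (q := 0) (fun _ => le_rfl)
    (fun _ => zero_le_one)).1
  unfold risk loss
  rw [← ofReal_integral_eq_lintegral_ofReal (h1.div_const _) (ae_of_all _ fun x => by positivity),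
    integral_div]

/-- The case `q = 0`: comparison with no shrinkage. -/
theorem risk_glEstimator_le {n m : ℕ} {J : Fin m → Set ℝ} {V : Fin n → ℝ}
    (hJ : IsBinning J) (hV : ∀ i, 0 < V i) (θ : Fin n → ℝ) :
    risk V θ (glEstimator J V) ≤ ENNReal.ofReal ((∑ i, V i) / (n : ℝ)) := by
  rw [risk_glEstimator_eq hJ hV]
  refine ENNReal.ofReal_le_ofReal (div_le_div_of_nonneg_right ?_ (Nat.cast_nonneg n))
  simpa using (integral_sum_sq_glEstimator_le hJ hV θ (q := 0) (fun _ => le_rfl)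
    (fun _ => zero_le_one)).2

/-- The gain stands on the left so that all terms are nonnegative extended reals. The inequality can
then be averaged over the means even where the expected sums of squares are infinite. -/
theorem risk_glEstimator_add_le {n m : ℕ} {J : Fin m → Set ℝ} {V : Fin n → ℝ}
    (hJ : IsBinning J) (hV : ∀ i, 0 < V i) (θ : Fin n → ℝ) {q : Fin m → ℝ}
    (hq0 : ∀ k, 0 ≤ q k) (hq1 : ∀ k, q k ≤ 1) :
    risk V θ (glEstimator J V) + ENNReal.ofReal ((∑ k, 2 * binThreshold J V k * q k) / (n : ℝ)) ≤
      ENNReal.ofReal ((∑ i, V i) / (n : ℝ)) + ∑ k, ENNReal.ofReal (q k ^ 2 / (n : ℝ)) *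
        ∫⁻ x, ENNReal.ofReal (groupSS (binIdx J V k) x) ∂gaussModel V θ := by
  have h := (integral_sum_sq_glEstimator_le hJ hV θ hq0 hq1).2
  have hSS : ∀ k, 0 ≤ ∫ x, groupSS (binIdx J V k) x ∂gaussModel V θ := fun k =>
    integral_nonneg groupSS_nonneg
  have hT : ∀ k, 0 ≤ 2 * binThreshold J V k * q k := fun k =>
    mul_nonneg (mul_nonneg zero_le_two (binThreshold_nonneg hV k)) (hq0 k)
  have e : ∀ k, ENNReal.ofReal (q k ^ 2 / (n : ℝ)) *
      ∫⁻ x, ENNReal.ofReal (groupSS (binIdx J V k) x) ∂gaussModel V θ =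
      ENNReal.ofReal (q k ^ 2 / (n : ℝ) * ∫ x, groupSS (binIdx J V k) x ∂gaussModel V θ) := by
    intro k
    rw [← ofReal_integral_eq_lintegral_ofReal (integrable_groupSS _ V θ)
      (ae_of_all _ groupSS_nonneg), ← ENNReal.ofReal_mul (by positivity)]
  simp_rw [e]
  rw [risk_glEstimator_eq hJ hV, ← ENNReal.ofReal_sum_of_nonneg
      (fun k _ => mul_nonneg (by positivity) (hSS k)),
    ← ENNReal.ofReal_add
      (div_nonneg (integral_nonneg fun x => by positivity) (Nat.cast_nonneg n))
      (div_nonneg (Finset.sum_nonneg fun k _ => hT k) (Nat.cast_nonneg n)),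
    ← ENNReal.ofReal_add
      (div_nonneg (Finset.sum_nonneg fun i _ => (hV i).le) (Nat.cast_nonneg n))
      (Finset.sum_nonneg fun k _ => mul_nonneg (by positivity) (hSS k))]
  refine ENNReal.ofReal_le_ofReal ?_
  have e2 : ∀ k, q k ^ 2 / (n : ℝ) * ∫ x, groupSS (binIdx J V k) x ∂gaussModel V θ =
      (q k ^ 2 * ∫ x, groupSS (binIdx J V k) x ∂gaussModel V θ) / (n : ℝ) := fun k => by ring
  simp_rw [e2]
  rw [← Finset.sum_div, ← add_div, ← add_div]
  refine div_le_div_of_nonneg_right ?_ (Nat.cast_nonneg n)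
  rw [Finset.sum_add_distrib, Finset.sum_neg_distrib] at h
  linarith

/-! ### Minimaxity -/

/-- Normal conjugacy, by completing the square in `t`: the posterior has mean `T x / (v + T)` and
variance `v T / (v + T)`. -/
theorem gaussianPDFReal_mul_gaussianPDFReal {v T : ℝ≥0} (hv : v ≠ 0) (hT : T ≠ 0) (t x : ℝ) :
    gaussianPDFReal 0 T t * gaussianPDFReal t v x =
      gaussianPDFReal 0 (v + T) x *
        gaussianPDFReal ((T / (v + T) : ℝ) * x) (v * T / (v + T)) t := by
  have hv' : (0 : ℝ) < v := by positivity
  have hT' : (0 : ℝ) < T := by positivity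
  have hpi := Real.pi_pos
  simp only [gaussianPDFReal, NNReal.coe_add, NNReal.coe_div, NNReal.coe_mul]
  have hs : (√(2 * Real.pi * T))⁻¹ * (√(2 * Real.pi * v))⁻¹ =
      (√(2 * Real.pi * (v + T)))⁻¹ * (√(2 * Real.pi * (v * T / (v + T))))⁻¹ := by
    rw [← mul_inv, ← mul_inv, ← Real.sqrt_mul (by positivity), ← Real.sqrt_mul (by positivity)]
    congr 2
    field_simp
  have he : -(t - 0) ^ 2 / (2 * (T : ℝ)) + -(x - t) ^ 2 / (2 * v) =
      -(x - 0) ^ 2 / (2 * (v + T)) +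
        -(t - T / (v + T) * x) ^ 2 / (2 * (v * T / (v + T))) := by
    field_simp
    ring
  calc _ = ((√(2 * Real.pi * T))⁻¹ * (√(2 * Real.pi * v))⁻¹) *
        Real.exp (-(t - 0) ^ 2 / (2 * (T : ℝ)) + -(x - t) ^ 2 / (2 * v)) := by
        rw [Real.exp_add]; ring
    _ = _ := by rw [hs, he, Real.exp_add]; ring

theorem lintegral_gaussianReal {μ : ℝ} {v : ℝ≥0} (hv : v ≠ 0) {f : ℝ → ℝ≥0∞} (hf : Measurable f) :
    ∫⁻ t, f t ∂gaussianReal μ v = ∫⁻ t, gaussianPDF μ v t * f t := by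
  rw [gaussianReal_of_var_ne_zero μ hv,
    lintegral_withDensity_eq_lintegral_mul _ (measurable_gaussianPDF μ v) hf]
  rfl

/-- The posterior of a normal mean under a centered normal prior. -/
def posteriorKernel (v T : ℝ) : Kernel ℝ ℝ :=
  normalKernel.comap (fun x => (v * T / (v + T), T / (v + T) * x)) (by fun_prop)

instance (v T : ℝ) : IsMarkovKernel (posteriorKernel v T) := by
  unfold posteriorKernel; infer_instance

theorem gaussianReal_compProd_normalKernel {v T : ℝ} (hv : 0 < v) (hT : 0 < T) :
    gaussianReal 0 T.toNNReal ⊗ₘ normalKernel.sectR v =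
      (gaussianReal 0 (v + T).toNNReal ⊗ₘ posteriorKernel v T).map Prod.swap := by
  lift v to ℝ≥0 using hv.le
  lift T to ℝ≥0 using hT.le
  have hv0 : v ≠ 0 := by rintro rfl; simp at hv
  have hT0 : T ≠ 0 := by rintro rfl; simp at hT
  have hvT : v + T ≠ 0 := by positivity
  have hW : v * T / (v + T) ≠ 0 := by positivity
  have e1 : ((v : ℝ) + T).toNNReal = v + T := by rw [← NNReal.coe_add, Real.toNNReal_coe]
  have e2 : ((v : ℝ) * T / (v + T)).toNNReal = v * T / (v + T) := by
    rw [← NNReal.coe_add, ← NNReal.coe_mul, ← NNReal.coe_div, Real.toNNReal_coe]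
  refine Measure.ext_of_lintegral _ fun f hf => ?_
  rw [lintegral_map hf measurable_swap, Measure.lintegral_compProd hf,
    Measure.lintegral_compProd (f := fun p : ℝ × ℝ => f p.swap) (hf.comp measurable_swap), e1,
    Real.toNNReal_coe]
  have l1 : ∀ t : ℝ, ∫⁻ x, f (t, x) ∂(normalKernel.sectR (v : ℝ)) t =
      ∫⁻ x, gaussianPDF t v x * f (t, x) := fun t => by
    change ∫⁻ x, f (t, x) ∂gaussianReal t (v : ℝ).toNNReal = _
    rw [Real.toNNReal_coe, lintegral_gaussianReal hv0 (by fun_prop)]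
  have l2 : ∀ x : ℝ, ∫⁻ t, f (Prod.swap (x, t)) ∂(posteriorKernel v T) x =
      ∫⁻ t, gaussianPDF ((T / (v + T) : ℝ) * x) (v * T / (v + T)) t * f (t, x) := fun x => by
    change ∫⁻ t, f (t, x) ∂gaussianReal _ ((v : ℝ) * T / (v + T)).toNNReal = _
    rw [e2, lintegral_gaussianReal hW (by fun_prop)]
  have m1 : Measurable fun p : ℝ × ℝ => gaussianPDF p.1 v p.2 :=
    measurable_uncurry_gaussianPDF.comp
      (measurable_fst.prodMk (measurable_const.prodMk measurable_snd))
  have m2 : Measurable fun p : ℝ × ℝ =>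
      gaussianPDF ((T / (v + T) : ℝ) * p.1) (v * T / (v + T)) p.2 :=
    measurable_uncurry_gaussianPDF.comp
      ((measurable_fst.const_mul _).prodMk (measurable_const.prodMk measurable_snd))
  simp_rw [l1, l2]
  have i1 : Measurable fun p : ℝ × ℝ => gaussianPDF p.1 v p.2 * f (p.1, p.2) := m1.mul hf
  have i2 : Measurable fun p : ℝ × ℝ =>
      gaussianPDF ((T / (v + T) : ℝ) * p.1) (v * T / (v + T)) p.2 * f (p.2, p.1) :=
    m2.mul (hf.comp measurable_swap)
  rw [lintegral_gaussianReal hT0 i1.lintegral_prod_right',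
    lintegral_gaussianReal hvT i2.lintegral_prod_right']
  have c1 : ∀ t, gaussianPDF 0 T t * ∫⁻ x, gaussianPDF t v x * f (t, x) =
      ∫⁻ x, gaussianPDF 0 T t * (gaussianPDF t v x * f (t, x)) := fun t =>
    (lintegral_const_mul _ (i1.comp measurable_prodMk_left)).symm
  have c2 : ∀ x, gaussianPDF 0 (v + T) x *
      ∫⁻ t, gaussianPDF ((T / (v + T) : ℝ) * x) (v * T / (v + T)) t * f (t, x) =
      ∫⁻ t, gaussianPDF 0 (v + T) x *
        (gaussianPDF ((T / (v + T) : ℝ) * x) (v * T / (v + T)) t * f (t, x)) := fun x =>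
    (lintegral_const_mul _ (i2.comp measurable_prodMk_left)).symm
  simp_rw [c1, c2]
  rw [lintegral_lintegral_swap
    (((measurable_gaussianPDF 0 T).comp measurable_fst).mul i1).aemeasurable]
  refine lintegral_congr fun x => lintegral_congr fun t => ?_
  rw [← mul_assoc, ← mul_assoc]
  congr 1
  simp only [gaussianPDF]
  rw [← ENNReal.ofReal_mul (gaussianPDFReal_nonneg _ _ _),
    ← ENNReal.ofReal_mul (gaussianPDFReal_nonneg _ _ _),
    gaussianPDFReal_mul_gaussianPDFReal hv0 hT0]

/-- The posterior of the means in the Gaussian model under centered normal priors. -/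
def gaussPosterior {n : ℕ} (V : Fin n → ℝ) (T : ℝ) : Kernel (Fin n → ℝ) (Fin n → ℝ) :=
  piKernel fun i =>
    (posteriorKernel (V i) T).comap (fun x : Fin n → ℝ => x i) (measurable_pi_apply i)

instance {n : ℕ} (V : Fin n → ℝ) (T : ℝ) : IsMarkovKernel (gaussPosterior V T) := by
  unfold gaussPosterior; infer_instance

theorem pi_compProd_gaussModel {n : ℕ} {V : Fin n → ℝ} (hV : ∀ i, 0 < V i) {T : ℝ}
    (hT : 0 < T) :
    (Measure.pi fun _ : Fin n => gaussianReal 0 T.toNNReal) ⊗ₘ gaussModel V =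
      ((Measure.pi fun i => gaussianReal 0 (V i + T).toNNReal) ⊗ₘ
        gaussPosterior V T).map Prod.swap := by
  have h1 := map_pi_compProd (fun _ : Fin n => gaussianReal 0 T.toNNReal)
    (fun i => normalKernel.sectR (V i))
  have h2 := map_pi_compProd (fun i => gaussianReal 0 (V i + T).toNNReal)
    (fun i => posteriorKernel (V i) T)
  have h3 : (Measure.pi fun i => gaussianReal 0 T.toNNReal ⊗ₘ normalKernel.sectR (V i)) =
      (Measure.pi fun i => gaussianReal 0 (V i + T).toNNReal ⊗ₘ posteriorKernel (V i) T).map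
        fun z i => (z i).swap := by
    rw [Measure.pi_map_pi fun i => measurable_swap.aemeasurable]
    simp_rw [fun i => gaussianReal_compProd_normalKernel (hV i) hT]
  rw [h3, Measure.map_map (MeasurableEquiv.measurable _) (by fun_prop)] at h1
  rw [gaussPosterior, ← h2, Measure.map_map measurable_swap (MeasurableEquiv.measurable _)]
  exact h1.symm

/-- The Bayes risk of the Gaussian model under centered normal priors with variance `T`. -/
theorem le_bayesRisk_gaussModel {n : ℕ} {V : Fin n → ℝ} (hV : ∀ i, 0 < V i) {T : ℝ}
    (hT : 0 < T) :
    ENNReal.ofReal ((∑ i, V i * T / (V i + T)) / (n : ℝ)) ≤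
      bayesRisk loss (gaussModel V) (Measure.pi fun _ => gaussianReal 0 T.toNNReal) := by
  refine le_iInf₂ fun δ _ => ?_
  set W : Fin n → ℝ := fun i => V i * T / (V i + T) with hW
  have hWpos : ∀ i, 0 < W i := fun i => by have := hV i; positivity
  set post := gaussPosterior V T
  have hswap := pi_compProd_gaussModel hV hT
  have hrisk : ∀ θ, ∫⁻ y, loss θ y ∂(δ ∘ₖ gaussModel V) θ =
      ∫⁻ x, ∫⁻ y, loss θ y ∂δ x ∂gaussModel V θ := fun θ =>
    Kernel.lintegral_comp _ _ _ (measurable_loss_right θ)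
  have hF : Measurable fun p : (Fin n → ℝ) × (Fin n → ℝ) => ∫⁻ y, loss p.1 y ∂δ p.2 := by
    have h : Measurable fun p : (Fin n → ℝ) × (Fin n → ℝ) =>
        ∫⁻ y, loss p.1 y ∂(δ.comap Prod.snd measurable_snd) p :=
      Measurable.lintegral_kernel_prod_right
        (f := fun (p : (Fin n → ℝ) × (Fin n → ℝ)) (y : Fin n → ℝ) => loss p.1 y)
        (by unfold Function.uncurry loss; fun_prop)
    exact h
  unfold avgRisk
  simp_rw [hrisk]
  -- The average over prior and model becomes one over marginal and posterior, so the posterior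
  -- expected loss can be bounded for each observation.
  rw [← Measure.lintegral_compProd (f := fun p => ∫⁻ y, loss p.1 y ∂δ p.2) hF, hswap,
    lintegral_map hF measurable_swap,
    Measure.lintegral_compProd (f := fun p : (Fin n → ℝ) × (Fin n → ℝ) =>
      ∫⁻ y, loss p.swap.1 y ∂δ p.swap.2) (hF.comp measurable_swap)]
  have hinner : ∀ x : Fin n → ℝ, ENNReal.ofReal ((∑ i, W i) / (n : ℝ)) ≤
      ∫⁻ θ, ∫⁻ y, loss θ y ∂δ x ∂post x := by
    intro x
    rw [lintegral_lintegral_swap (measurable_loss (n := n)).aemeasurable]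
    -- The posterior is again a Gaussian model, with variances `W`, so every action costs at least
    -- the average of `W`. Averaging over a randomized action keeps this bound.
    have hy : ∀ y, ENNReal.ofReal ((∑ i, W i) / (n : ℝ)) ≤ ∫⁻ θ, loss θ y ∂post x := by
      intro y
      obtain ⟨h1, h2⟩ := integral_sum_sq_gaussModel hWpos (fun i => T / (V i + T) * x i) y
      have hp : post x = gaussModel W fun i => T / (V i + T) * x i := rfl
      have hl : ∀ θ, loss θ y = ENNReal.ofReal ((∑ i, (θ i - y i) ^ 2) / (n : ℝ)) := fun θ => by
        simp only [loss, sub_sq_comm]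
      simp_rw [hp, hl]
      rw [← ofReal_integral_eq_lintegral_ofReal (h1.div_const _)
        (ae_of_all _ fun x => by positivity), integral_div, h2]
      gcongr with i
      exact le_add_of_nonneg_right (sq_nonneg _)
    calc _ = ∫⁻ _, ENNReal.ofReal ((∑ i, W i) / (n : ℝ)) ∂δ x := by simp
      _ ≤ _ := lintegral_mono hy
  calc _ = ∫⁻ _, ENNReal.ofReal ((∑ i, W i) / (n : ℝ))
        ∂Measure.pi fun i => gaussianReal 0 (V i + T).toNNReal := by simp
    _ ≤ _ := lintegral_mono hinner

/-- Every Bayes risk is a lower bound, and `V_i T / (V_i + T) → V_i` as the priors flatten. -/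
theorem le_minimaxRisk_gaussModel {n : ℕ} {V : Fin n → ℝ} (hV : ∀ i, 0 < V i) :
    ENNReal.ofReal ((∑ i, V i) / (n : ℝ)) ≤ minimaxRisk loss (gaussModel V) := by
  have hlim : Tendsto (fun T : ℝ => ENNReal.ofReal ((∑ i, V i * T / (V i + T)) / (n : ℝ))) atTop
      (𝓝 (ENNReal.ofReal ((∑ i, V i) / (n : ℝ)))) := by
    refine ENNReal.tendsto_ofReal (Tendsto.div_const (tendsto_finsetSum _ fun i _ => ?_) _)
    have h : Tendsto (fun T : ℝ => V i - V i ^ 2 / (V i + T)) atTop (𝓝 (V i - 0)) :=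
      tendsto_const_nhds.sub
        (tendsto_const_nhds.div_atTop (tendsto_atTop_add_const_left _ _ tendsto_id))
    rw [sub_zero] at h
    refine h.congr' ?_
    filter_upwards [eventually_gt_atTop 0] with T hT
    have := hV i
    field_simp
    ring
  refine le_of_tendsto hlim ?_
  filter_upwards [eventually_gt_atTop 0] with T hT
  exact (le_bayesRisk_gaussModel hV hT).trans (bayesRisk_le_minimaxRisk _ _ _)

/-- The maximal risk is at most `V̄`, which is at most the minimax risk. Conversely, a measurable
estimator is a deterministic kernel and so competes in the infimum. -/
theorem isMinimax_glEstimator {n m : ℕ} {J : Fin m → Set ℝ} {V : Fin n → ℝ}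
    (hJ : IsBinning J) (hV : ∀ i, 0 < V i) : IsMinimax V (glEstimator J V) := by
  have hmeas := measurable_glEstimator (J := J) (V := V)
  refine ⟨hmeas, le_antisymm ?_ ?_⟩
  · exact (iSup_le fun θ => risk_glEstimator_le hJ hV θ).trans (le_minimaxRisk_gaussModel hV)
  · unfold minimaxRisk
    refine (iInf₂_le (Kernel.deterministic _ hmeas)
      (Kernel.isMarkovKernel_deterministic hmeas)).trans (iSup_mono fun θ => ?_)
    rw [Kernel.lintegral_comp _ _ _ (measurable_loss_right θ), risk]
    refine le_of_eq (lintegral_congr fun x => ?_)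
    rw [Kernel.lintegral_deterministic' _ (measurable_loss_right θ)]

/-! ### The oracle inequality -/

theorem bStar_eq_zero (κ : Kernel ℝ ℝ) {v : ℝ}
    (h : evariance (fun p : ℝ × ℝ => p.2) (popKernel κ v) = ∞) :
    bStar κ v = 0 := by
  simp [bStar, variance, h]

theorem bStar_nonneg (κ : Kernel ℝ ℝ) {v : ℝ} (hv : 0 < v) : 0 ≤ bStar κ v :=
  div_nonneg hv.le (variance_nonneg _ _)

section Oracle

variable (κ : Kernel ℝ ℝ) [IsMarkovKernel κ] {v : ℝ}

/-- Given the mean `t`, the second moment splits into the variance `c² v` and the square of the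
conditional mean. With extended values no moment of `κ v` is required. -/
theorem lintegral_affine_sq_popKernel (hv : 0 < v) (c d e : ℝ) :
    ∫⁻ p, ENNReal.ofReal ((c * p.2 + d * p.1 + e) ^ 2) ∂popKernel κ v =
      ENNReal.ofReal (c ^ 2 * v) + ∫⁻ t, ENNReal.ofReal (((c + d) * t + e) ^ 2) ∂κ v := by
  rw [lintegral_popKernel κ v (by fun_prop)]
  have h : ∀ t : ℝ, ∫⁻ y, ENNReal.ofReal ((c * y + d * t + e) ^ 2) ∂gaussianReal t v.toNNReal =
      ENNReal.ofReal (c ^ 2 * v) + ENNReal.ofReal (((c + d) * t + e) ^ 2) := by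
    intro t
    have := lintegral_affine_sq_gaussianReal t v.toNNReal c (d * t + e)
    simp_rw [← add_assoc] at this
    rw [this, Real.coe_toNNReal _ hv.le, ENNReal.ofReal_add (by positivity) (sq_nonneg _)]
    congr 3
    ring
  simp_rw [h]
  rw [lintegral_add_left measurable_const]
  simp

/-- Law of total variance. If `Y` is not integrable, `aStar` is the default value `0` of the
integral, which is also the centre used by `evariance`. -/
theorem evariance_popKernel (hv : 0 < v) :
    evariance (fun p : ℝ × ℝ => p.2) (popKernel κ v) =
      ENNReal.ofReal v + ∫⁻ t, ENNReal.ofReal ((t - aStar κ v) ^ 2) ∂κ v := by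
  have h := lintegral_affine_sq_popKernel κ hv 1 0 (-aStar κ v)
  simp only [one_mul, zero_mul, add_zero, one_pow, ← sub_eq_add_neg] at h
  rw [← h, evariance]
  refine lintegral_congr fun p => ?_
  rw [← ofReal_norm, ← ENNReal.ofReal_pow (norm_nonneg _), Real.norm_eq_abs, sq_abs]
  rfl

theorem le_variance_popKernel (hv : 0 < v)
    (h : evariance (fun p : ℝ × ℝ => p.2) (popKernel κ v) ≠ ∞) :
    v ≤ variance (fun p : ℝ × ℝ => p.2) (popKernel κ v) := by
  rw [variance, ← ENNReal.ofReal_le_iff_le_toReal h, evariance_popKernel κ hv]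
  exact le_self_add

theorem bStar_le_one (hv : 0 < v) : bStar κ v ≤ 1 := by
  by_cases h : evariance (fun p : ℝ × ℝ => p.2) (popKernel κ v) = ∞
  · rw [bStar_eq_zero κ h]; exact zero_le_one
  · exact div_le_one_of_le₀ (le_variance_popKernel κ hv h) (variance_nonneg _ _)

/-- If `s = Var(Y | A = v)` is finite, the risk is `(1 - b)² v + b² (s - v)`, which equals `v (1 -
b)` at `b = v / s`. If the variance is infinite, then `b = 0` and the risk is `v`. -/
theorem condBayesRisk_eq (hv : 0 < v) :
    condBayesRisk κ (aStar κ) (bStar κ) v = ENNReal.ofReal (v * (1 - bStar κ v)) := by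
  set b := bStar κ v with hb
  set a := aStar κ v with ha
  have h := lintegral_affine_sq_popKernel κ hv (1 - b) (-1) (b * a)
  have h1 : condBayesRisk κ (aStar κ) (bStar κ) v =
      ENNReal.ofReal ((1 - b) ^ 2 * v) +
        ENNReal.ofReal (b ^ 2) * ∫⁻ t, ENNReal.ofReal ((t - a) ^ 2) ∂κ v := by
    rw [← lintegral_const_mul _ (by fun_prop)]
    simp_rw [← ENNReal.ofReal_mul (sq_nonneg b)]
    unfold condBayesRisk
    rw [← hb, ← ha]
    convert h using 4
    · ring_nf
    · ring_nf
  rw [h1]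
  by_cases hT : evariance (fun p : ℝ × ℝ => p.2) (popKernel κ v) = ∞
  · have hb0 : b = 0 := bStar_eq_zero κ hT
    simp [hb0]
  · have hle := le_variance_popKernel κ hv hT
    set s := variance (fun p : ℝ × ℝ => p.2) (popKernel κ v) with hs
    have hs0 : 0 < s := hv.trans_le hle
    have hT' : ∫⁻ t, ENNReal.ofReal ((t - a) ^ 2) ∂κ v = ENNReal.ofReal (s - v) := by
      have he : ENNReal.ofReal s = _ := (ENNReal.ofReal_toReal hT).trans (evariance_popKernel κ hv)
      rw [ENNReal.ofReal_sub _ hv.le, he, ENNReal.add_sub_cancel_left ENNReal.ofReal_ne_top]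
    rw [hT', ← ENNReal.ofReal_mul (sq_nonneg b), ← ENNReal.ofReal_add (by positivity)
      (mul_nonneg (sq_nonneg _) (by linarith))]
    congr 1
    have hbs : b = v / s := rfl
    rw [hbs]
    field_simp
    ring

/-- Decomposition into variance and squared bias. Positivity of `b*` excludes infinite variance and
makes `v / b*` the variance. -/
theorem lintegral_sq_sub_popKernel (hb : 0 < bStar κ v) (t : ℝ) :
    ∫⁻ p, ENNReal.ofReal ((p.2 - t) ^ 2) ∂popKernel κ v =
      ENNReal.ofReal (v / bStar κ v + (aStar κ v - t) ^ 2) := by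
  have hfin : evariance (fun p : ℝ × ℝ => p.2) (popKernel κ v) ≠ ∞ := fun h =>
    hb.ne' (bStar_eq_zero κ h)
  have hL : MemLp (fun p : ℝ × ℝ => p.2) 2 (popKernel κ v) :=
    (evariance_lt_top_iff_memLp (by fun_prop)).1 hfin.lt_top
  have hLt : MemLp (fun p : ℝ × ℝ => p.2 - t) 2 (popKernel κ v) := hL.sub (memLp_const t)
  have hvar := variance_eq_sub hLt
  rw [variance_sub_const (by fun_prop),
    integral_sub (hL.integrable (by norm_num)) (integrable_const t)] at hvar
  have hvb : v / bStar κ v = variance (fun p : ℝ × ℝ => p.2) (popKernel κ v) := by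
    have hv0 : v ≠ 0 := by rintro rfl; simp [bStar] at hb
    rw [bStar, div_div_cancel₀ hv0]
  rw [← ofReal_integral_eq_lintegral_ofReal hLt.integrable_sq (ae_of_all _ fun _ => sq_nonneg _),
    hvb, hvar]
  congr 1
  simp [aStar]

end Oracle

/-- The conditional risk is the risk averaged over the conditional law of the means. -/
theorem condRisk_eq (κ : Kernel ℝ ℝ) [IsMarkovKernel κ] {n m : ℕ} (J : Fin m → Set ℝ)
    (v : Fin n → ℝ) :
    condRisk κ J v = ∫⁻ θ, risk v θ (glEstimator J v) ∂Measure.pi fun i => κ (v i) := by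
  have hgl := measurable_glEstimator (J := J) (V := v)
  exact lintegral_sampleKernel κ v (f := fun θ x => loss θ (glEstimator J v x))
    (by unfold Function.uncurry loss; fun_prop)

theorem sum_eq_sum_bins {n m : ℕ} {J : Fin m → Set ℝ} (hJ : IsBinning J) (V : Fin n → ℝ)
    (f : Fin n → ℝ) [∀ i, Decidable (V i ∈ ⋃ k, J k)] :
    ∑ i, f i = ∑ k, ∑ i ∈ binIdx J V k, f i +
      ∑ i, if V i ∈ ⋃ k, J k then 0 else f i := by
  classical
  have hcomm : ∑ k, ∑ i ∈ binIdx J V k, f i =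
      ∑ i, ∑ k, if i ∈ binIdx J V k then f i else 0 := by
    rw [Finset.sum_comm]
    exact Finset.sum_congr rfl fun k _ => by simp
  rw [hcomm, ← Finset.sum_add_distrib]
  refine Finset.sum_congr rfl fun i _ => ?_
  by_cases hi : V i ∈ ⋃ k, J k
  · obtain ⟨k, hk⟩ := Set.mem_iUnion.1 hi
    rw [if_pos hi, add_zero, Fintype.sum_eq_single k fun l hl => if_neg fun hil =>
      Set.disjoint_left.1 (hJ.disjoint hl) (mem_binIdx.1 hil) hk, if_pos (mem_binIdx.2 hk)]
  · have : ∀ k, i ∉ binIdx J V k := fun k hk => hi (Set.mem_iUnion.2 ⟨k, mem_binIdx.1 hk⟩)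
    simp [hi, this]

/-- The cost of the constant `c_k` and of the estimated bin mean. -/
theorem sum_sub_binThreshold_le {n m : ℕ} {J : Fin m → Set ℝ} {V : Fin n → ℝ}
    (hV : ∀ i, 0 < V i) {k : Fin m} (hk : 2 ≤ binSize J V k) {δ : ℝ}
    (hδ : ∀ i ∈ binIdx J V k, ∀ j ∈ binIdx J V k, |V i - V j| ≤ δ) :
    ∑ i ∈ binIdx J V k, V i - binThreshold J V k ≤ 3 * binMean J V V k + 2 * δ := by
  have hk' : (2 : ℝ) ≤ binSize J V k := by exact_mod_cast hk
  have hpos : 0 < binSize J V k := by omega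
  have hm := binMean_pos (J := J) hV hpos
  have hsum : ∑ i ∈ binIdx J V k, V i = binSize J V k * binMean J V V k := by
    rw [binMean]; field_simp
  have hmax : binMax J V k ≤ binMean J V V k + δ := by
    refine binMax_le hpos fun i hi => ?_
    have h : ∑ j ∈ binIdx J V k, (V i - δ) ≤ ∑ j ∈ binIdx J V k, V j :=
      Finset.sum_le_sum fun j hj => by have := (abs_le.1 (hδ i hi j hj)).2; linarith
    rw [hsum, Finset.sum_const, nsmul_eq_mul] at h
    have := le_of_mul_le_mul_left h (by linarith : (0 : ℝ) < binSize J V k)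
    linarith
  have hr : (0 : ℝ) < binSize J V k - 1 := by linarith
  have hc : 1 - 2 * (binMax J V k / binMean J V V k) / ((binSize J V k : ℝ) - 1) ≤
      shrinkConst J V k := le_max_left _ _
  -- Together with `binMax ≤ V̄_k + δ` this leaves `n_k V̄_k - E ≤ V̄_k + 2 (V̄_k + δ)`.
  have hE : (binSize J V k - 1) * binMean J V V k - 2 * binMax J V k ≤ binThreshold J V k := by
    calc _ = (binSize J V k - 1) *
          (1 - 2 * (binMax J V k / binMean J V V k) / ((binSize J V k : ℝ) - 1)) *
          binMean J V V k := by field_simp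
      _ ≤ _ := by rw [binThreshold]; gcongr
  rw [hsum]
  linarith

open Classical in
/-- The conditional risk for finite samples, in terms of the oscillations of the optimal location
and slope within the bins. -/
theorem condRisk_le (κ : Kernel ℝ ℝ) [IsMarkovKernel κ] {n m : ℕ} {J : Fin m → Set ℝ}
    (hJ : IsBinning J) {v : Fin n → ℝ} (hv : ∀ i, 0 < v i) {N : ℕ} (hN : 2 ≤ N)
    (hsize : ∀ k, N ≤ binSize J v k) {δ α β : ℝ} (hδ0 : 0 ≤ δ)
    (hδ : ∀ k, ∀ i ∈ binIdx J v k, ∀ j ∈ binIdx J v k, |v i - v j| ≤ δ)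
    (hα : ∀ k, ∀ i ∈ binIdx J v k, ∀ j ∈ binIdx J v k, |aStar κ (v i) - aStar κ (v j)| ≤ α)
    (hβ0 : 0 ≤ β)
    (hβ : ∀ k, ∀ i ∈ binIdx J v k, ∀ j ∈ binIdx J v k, |bStar κ (v i) - bStar κ (v j)| ≤ β) :
    condRisk κ J v ≤
      (∑ i, condBayesRisk κ (aStar κ) (bStar κ) (v i)) / (n : ℝ≥0∞) +
        ENNReal.ofReal ((∑ i, (β * v i + α ^ 2 + 6 * (v i / N) + 4 * δ)) / (n : ℝ) +
          (∑ i, if v i ∈ ⋃ k, J k then 0 else v i) / (n : ℝ)) := by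
  rcases Nat.eq_zero_or_pos n with rfl | hn
  · simp [condRisk, loss]
  have hn' : (0 : ℝ) < n := by exact_mod_cast hn
  have hne : ∀ k, (binIdx J v k).Nonempty := fun k =>
    Finset.card_pos.1 (by have := hsize k; unfold binSize at this; omega)
  -- Shrinking by the smallest `b*` of the bin gives `q v_i / b*(v_i) ≤ v_i`. If some conditional
  -- variance in the bin is infinite, then `q = 0` and the infinite sum of squares has weight zero.
  choose i₀ hi₀ hmin using fun k => Finset.exists_min_image (binIdx J v k)
    (fun i => bStar κ (v i)) (hne k)
  set q : Fin m → ℝ := fun k => bStar κ (v (i₀ k)) with hq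
  have hq0 : ∀ k, 0 ≤ q k := fun k => bStar_nonneg κ (hv _)
  have hq1 : ∀ k, q k ≤ 1 := fun k => bStar_le_one κ (hv _)
  -- the expected sum of squares of a bin
  have hSS : ∀ k, ENNReal.ofReal (q k ^ 2 / (n : ℝ)) *
      ∫⁻ z, ENNReal.ofReal (groupSS (binIdx J v k) fun i => (z i).2) ∂sampleKernel κ n v ≤
      ENNReal.ofReal ((∑ i ∈ binIdx J v k, (q k * v i + α ^ 2)) / (n : ℝ)) := by
    intro k
    rcases (hq0 k).eq_or_lt with h0 | hqpos
    · simp [← h0]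
    have hbpos : ∀ i ∈ binIdx J v k, 0 < bStar κ (v i) := fun i hi => hqpos.trans_le (hmin k i hi)
    have h1 : ∫⁻ z, ENNReal.ofReal (groupSS (binIdx J v k) fun i => (z i).2) ∂sampleKernel κ n v ≤
        ENNReal.ofReal (∑ i ∈ binIdx J v k, (v i / bStar κ (v i) + α ^ 2)) := by
      calc _ ≤ ∫⁻ z, ∑ i ∈ binIdx J v k, ENNReal.ofReal (((z i).2 - aStar κ (v (i₀ k))) ^ 2)
            ∂sampleKernel κ n v := by
            refine lintegral_mono fun z => ?_
            rw [← ENNReal.ofReal_sum_of_nonneg fun _ _ => sq_nonneg _]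
            exact ENNReal.ofReal_le_ofReal (groupSS_le _ _)
        _ = ∑ i ∈ binIdx J v k,
            ENNReal.ofReal (v i / bStar κ (v i) + (aStar κ (v i) - aStar κ (v (i₀ k))) ^ 2) := by
            rw [lintegral_finsetSum _ fun i _ => by fun_prop]
            refine Finset.sum_congr rfl fun i hi => ?_
            rw [lintegral_sampleKernel_eval κ v i
              (f := fun p => ENNReal.ofReal ((p.2 - aStar κ (v (i₀ k))) ^ 2)) (by fun_prop),
              lintegral_sq_sub_popKernel κ (hbpos i hi)]
        _ ≤ ∑ i ∈ binIdx J v k, ENNReal.ofReal (v i / bStar κ (v i) + α ^ 2) := by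
            refine Finset.sum_le_sum fun i hi => ENNReal.ofReal_le_ofReal ?_
            gcongr 1
            exact sq_le_sq' (by linarith [(abs_le.1 (hα k i hi _ (hi₀ k))).1])
              (abs_le.1 (hα k i hi _ (hi₀ k))).2
        _ = _ := by
            rw [ENNReal.ofReal_sum_of_nonneg fun i hi => ?_]
            have := hv i; have := hbpos i hi; positivity
    refine (mul_le_mul_right h1 _).trans ?_
    rw [← ENNReal.ofReal_mul (by positivity), div_mul_eq_mul_div, Finset.mul_sum]
    refine ENNReal.ofReal_le_ofReal (div_le_div_of_nonneg_right ?_ hn'.le)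
    refine Finset.sum_le_sum fun i hi => ?_
    have hb := hbpos i hi
    have h2 : q k * v i / bStar κ (v i) ≤ v i := by
      rw [div_le_iff₀ hb, mul_comm]
      exact mul_le_mul_of_nonneg_left (hmin k i hi) (hv i).le
    have h3 : q k ^ 2 ≤ 1 := pow_le_one₀ (hq0 k) (hq1 k)
    calc q k ^ 2 * (v i / bStar κ (v i) + α ^ 2) =
        q k * (q k * v i / bStar κ (v i)) + q k ^ 2 * α ^ 2 := by ring
      _ ≤ q k * v i + 1 * α ^ 2 := by
        gcongr
      _ = _ := by ring
  -- the risk bound averaged over the means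
  have hgl := measurable_glEstimator (J := J) (V := v)
  have hcond := condRisk_eq κ J v
  have hrm : Measurable fun θ => risk v θ (glEstimator J v) :=
    Measurable.lintegral_kernel_prod_right (κ := gaussModel v)
      (f := fun θ x => loss θ (glEstimator J v x)) (by unfold Function.uncurry loss; fun_prop)
  have hssm : ∀ k, Measurable (Function.uncurry fun (_ x : Fin n → ℝ) =>
      ENNReal.ofReal (groupSS (binIdx J v k) x)) := fun k =>
    (continuous_groupSS.measurable.comp measurable_snd).ennreal_ofReal
  have hbound := lintegral_mono (μ := Measure.pi fun i => κ (v i)) fun θ =>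
    risk_glEstimator_add_le hJ hv θ hq0 hq1
  rw [lintegral_add_left hrm, ← hcond, lintegral_add_left measurable_const,
    lintegral_finsetSum _ fun k _ =>
      (Measurable.lintegral_kernel_prod_right (κ := gaussModel v) (hssm k)).const_mul _] at hbound
  simp only [lintegral_const, measure_univ, mul_one] at hbound
  have hssk : ∀ k, ∫⁻ θ, ENNReal.ofReal (q k ^ 2 / (n : ℝ)) *
      ∫⁻ x, ENNReal.ofReal (groupSS (binIdx J v k) x) ∂gaussModel v θ
        ∂Measure.pi (fun i => κ (v i)) ≤
      ENNReal.ofReal ((∑ i ∈ binIdx J v k, (q k * v i + α ^ 2)) / (n : ℝ)) := by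
    intro k
    rw [lintegral_const_mul _
      (Measurable.lintegral_kernel_prod_right (κ := gaussModel v) (hssm k)),
      ← lintegral_sampleKernel κ v (hssm k)]
    exact hSS k
  have hterm0 : ∀ k, 0 ≤ (∑ i ∈ binIdx J v k, (q k * v i + α ^ 2)) / (n : ℝ) := fun k =>
    div_nonneg (Finset.sum_nonneg fun i _ =>
      add_nonneg (mul_nonneg (hq0 k) (hv i).le) (sq_nonneg _)) hn'.le
  have hA0 : 0 ≤ (∑ k, 2 * binThreshold J v k * q k) / (n : ℝ) :=
    div_nonneg (Finset.sum_nonneg fun k _ =>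
      mul_nonneg (mul_nonneg zero_le_two (binThreshold_nonneg hv k)) (hq0 k)) hn'.le
  have hmain := hbound.trans (add_le_add_right (Finset.sum_le_sum fun k _ => hssk k) _)
  rw [← ENNReal.ofReal_sum_of_nonneg fun k _ => hterm0 k,
    ← ENNReal.ofReal_add (div_nonneg (Finset.sum_nonneg fun i _ => (hv i).le) hn'.le)
      (Finset.sum_nonneg fun k _ => hterm0 k)] at hmain
  -- The gain is finite, so it may be moved back to the right after averaging.
  have hmain' := ENNReal.le_sub_of_add_le_right ENNReal.ofReal_ne_top hmain
  rw [← ENNReal.ofReal_sub _ hA0] at hmain'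
  refine hmain'.trans ?_
  have hbayes : (∑ i, condBayesRisk κ (aStar κ) (bStar κ) (v i)) / (n : ℝ≥0∞) =
      ENNReal.ofReal ((∑ i, v i * (1 - bStar κ (v i))) / (n : ℝ)) := by
    have h0 : ∀ i, 0 ≤ v i * (1 - bStar κ (v i)) := fun i =>
      mul_nonneg (hv i).le (sub_nonneg.2 (bStar_le_one κ (hv i)))
    rw [ENNReal.ofReal_div_of_pos hn', ENNReal.ofReal_sum_of_nonneg fun i _ => h0 i,
      ENNReal.ofReal_natCast]
    exact congrArg (· / _) (Finset.sum_congr rfl fun i _ => condBayesRisk_eq κ (hv i))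
  rw [hbayes]
  refine le_trans (ENNReal.ofReal_le_ofReal ?_) ENNReal.ofReal_add_le
  rw [← Finset.sum_div, ← add_div, ← sub_div, ← add_div, ← add_div]
  refine div_le_div_of_nonneg_right ?_ hn'.le
  -- comparison bin by bin
  have hNpos : (0 : ℝ) < N := by exact_mod_cast (by omega : 0 < N)
  -- Replacing `b*` by `q + β` leaves `2 q (∑ v_i - E)` besides the `β` and `α²` terms. This is at
  -- most `6 V̄_k + 4 δ`; then `V̄_k ≤ ∑ v_i / N` and `δ ≤ n_k δ` spread it over the bin.
  have hbin : ∀ k, ∑ i ∈ binIdx J v k, v i * bStar κ (v i) +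
      ∑ i ∈ binIdx J v k, (q k * v i + α ^ 2) - 2 * binThreshold J v k * q k ≤
      ∑ i ∈ binIdx J v k, (β * v i + α ^ 2 + 6 * (v i / N) + 4 * δ) := by
    intro k
    have hkN : (N : ℝ) ≤ binSize J v k := by exact_mod_cast hsize k
    have hk1 : (1 : ℝ) ≤ binSize J v k := by
      exact_mod_cast (by have := hsize k; omega : 1 ≤ binSize J v k)
    have hthr := sum_sub_binThreshold_le hv (hN.trans (hsize k)) (hδ k)
    have hs0 : 0 ≤ ∑ i ∈ binIdx J v k, v i := Finset.sum_nonneg fun i _ => (hv i).le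
    have hmean : binMean J v v k ≤ (∑ i ∈ binIdx J v k, v i) / N :=
      div_le_div_of_nonneg_left hs0 hNpos hkN
    have h1 : ∑ i ∈ binIdx J v k, v i * bStar κ (v i) ≤
        (q k + β) * ∑ i ∈ binIdx J v k, v i := by
      rw [Finset.mul_sum]
      refine Finset.sum_le_sum fun i hi => ?_
      have := (abs_le.1 (hβ k i hi _ (hi₀ k))).2
      rw [mul_comm]
      exact mul_le_mul_of_nonneg_right (by simp only [hq]; linarith) (hv i).le
    have h2 : q k * (∑ i ∈ binIdx J v k, v i - binThreshold J v k) ≤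
        3 * binMean J v v k + 2 * δ :=
      (mul_le_mul_of_nonneg_left hthr (hq0 k)).trans (mul_le_of_le_one_left
        (add_nonneg (mul_nonneg (by norm_num) (binMean_nonneg hv k)) (by linarith)) (hq1 k))
    have h3 : δ ≤ binSize J v k * δ := le_mul_of_one_le_left hδ0 hk1
    have hcard : ((binIdx J v k).card : ℝ) = binSize J v k := rfl
    simp only [Finset.sum_add_distrib, ← Finset.mul_sum, ← Finset.sum_div, Finset.sum_const,
      nsmul_eq_mul, hcard]
    linarith
  have hsum := Finset.sum_le_sum fun k (_ : k ∈ Finset.univ) => hbin k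
  rw [Finset.sum_sub_distrib, Finset.sum_add_distrib] at hsum
  have e1 := sum_eq_sum_bins hJ v fun i => v i * bStar κ (v i)
  have e2 := sum_eq_sum_bins hJ v fun i => β * v i + α ^ 2 + 6 * (v i / N) + 4 * δ
  -- Outside the bins there is no shrinkage, and the excess over the oracle is `v b* ≤ v`.
  have e3 : (∑ i, if v i ∈ ⋃ k, J k then 0 else v i * bStar κ (v i)) ≤
      ∑ i, if v i ∈ ⋃ k, J k then 0 else v i := by
    refine Finset.sum_le_sum fun i _ => ?_
    split_ifs
    · exact le_rfl
    · exact mul_le_of_le_one_right (hv i).le (bStar_le_one κ (hv i))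
  have e4 : 0 ≤ ∑ i, if v i ∈ ⋃ k, J k then 0 else
      (β * v i + α ^ 2 + 6 * (v i / N) + 4 * δ) := by
    refine Finset.sum_nonneg fun i _ => ?_
    have := hv i
    split_ifs
    · exact le_rfl
    · positivity
  have e5 : ∑ i, v i * (1 - bStar κ (v i)) = ∑ i, v i - ∑ i, v i * bStar κ (v i) := by
    rw [← Finset.sum_sub_distrib]
    exact Finset.sum_congr rfl fun i _ => by ring
  linarith

/-! ### Asymptotics of the conditional risk. -/

theorem abs_sub_le_of_volume_le {J : Set ℝ} (hJ : J.OrdConnected) {δ : ℝ} (hδ : 0 ≤ δ)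
    (hvol : volume J ≤ ENNReal.ofReal δ) {x y : ℝ} (hx : x ∈ J) (hy : y ∈ J) : |x - y| ≤ δ := by
  wlog h : y ≤ x generalizing x y
  · rw [abs_sub_comm]; exact this hy hx (le_of_not_ge h)
  have h1 := (measure_mono (hJ.out hy hx)).trans hvol
  rw [Real.volume_Icc, ENNReal.ofReal_le_ofReal_iff hδ] at h1
  rwa [abs_of_nonneg (sub_nonneg.2 h)]

/-- The risk bound for fixed means does not depend on them, so it survives averaging even when `κ`
has no moments. -/
theorem condRisk_lt_top (κ : Kernel ℝ ℝ) [IsMarkovKernel κ] {n m : ℕ} {J : Fin m → Set ℝ}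
    (hJ : IsBinning J) {v : Fin n → ℝ} (hv : ∀ i, 0 < v i) : condRisk κ J v < ∞ := by
  rw [condRisk_eq]
  refine (lintegral_mono fun θ => risk_glEstimator_le hJ hv θ).trans_lt ?_
  simp

/-- The group-linear estimator asymptotically attains the conditional risk of the oracle. -/
theorem eventually_condRisk_le (κ : Kernel ℝ ℝ) [IsMarkovKernel κ] {S : Set ℝ} {v : ℕ → ℝ}
    {m : ℕ → ℕ} {J : ∀ n, Fin (m n) → Set ℝ} (hS : S ⊆ Set.Ioi 0) (hvS : ∀ i, v i ∈ S)
    (ha : UniformContinuousOn (aStar κ) S) (hb : UniformContinuousOn (bStar κ) S)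
    (hJ : ∀ n, IsBinning (J n)) (hloc : LocalCond v m J) {η : ℝ} (hη : 0 < η) :
    ∀ᶠ n : ℕ in atTop, condRisk κ (J n) (fun i : Fin n => v i) ≤
      (∑ i : Fin n, condBayesRisk κ (aStar κ) (bStar κ) (v i)) / (n : ℝ≥0∞) +
        ENNReal.ofReal η := by
  classical
  have hv : ∀ i, 0 < v i := fun i => hS (hvS i)
  obtain ⟨C₀, hC₀⟩ := hloc.bounded
  set C := max C₀ 0 with hC
  have hC0 : 0 ≤ C := le_max_right _ _
  -- The five errors, from `β`, `α²`, `N`, `δ` and the variances outside the bins, are each made at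
  -- most `η / 6`.
  set β := η / (6 * (C + 1)) with hβ
  have hβ0 : 0 < β := by positivity
  set α := √(η / 6) with hα
  have hα0 : 0 < α := Real.sqrt_pos.2 (by positivity)
  obtain ⟨δa, hδa, hua⟩ := Metric.uniformContinuousOn_iff.1 ha α hα0
  obtain ⟨δb, hδb, hub⟩ := Metric.uniformContinuousOn_iff.1 hb β hβ0
  set δ := min (η / 24) (min (δa / 2) (δb / 2)) with hδ
  have hδ0 : 0 < δ := by positivity
  have hδ1 : δ ≤ η / 24 := min_le_left _ _
  have hδ2 : δ < δa := ((min_le_right _ _).trans (min_le_left _ _)).trans_lt (by linarith)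
  have hδ3 : δ < δb := ((min_le_right _ _).trans (min_le_right _ _)).trans_lt (by linarith)
  obtain ⟨N₀, hN₀⟩ := exists_nat_ge (36 * C / η)
  set N := max N₀ 2 with hN
  have hN2 : 2 ≤ N := le_max_right _ _
  have hNC : 36 * C / η ≤ N := hN₀.trans (by exact_mod_cast le_max_left _ _)
  have hNpos : (0 : ℝ) < N := by exact_mod_cast (by omega : 0 < N)
  have hout := hloc.outside.eventually_le_const (by positivity : 0 < η / 6)
  filter_upwards [hC₀, hloc.length δ hδ0, hloc.size N, hout, eventually_gt_atTop 0]
    with n hCn hlen hsize houtn hn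
  have hn' : (0 : ℝ) < n := by exact_mod_cast hn
  have hdist : ∀ k, ∀ i ∈ binIdx (J n) (fun i : Fin n => v i) k,
      ∀ j ∈ binIdx (J n) (fun i : Fin n => v i) k, |v i - v j| ≤ δ := fun k i hi j hj =>
    abs_sub_le_of_volume_le ((hJ n).interval k) hδ0.le (hlen k) (mem_binIdx.1 hi) (mem_binIdx.1 hj)
  refine (condRisk_le κ (hJ n) (fun i => hv i) hN2 hsize hδ0.le hdist (α := α) (β := β)
    (fun k i hi j hj => ?_) hβ0.le (fun k i hi j hj => ?_)).trans ?_
  · exact (hua _ (hvS i) _ (hvS j) ((hdist k i hi j hj).trans_lt hδ2)).le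
  · exact (hub _ (hvS i) _ (hvS j) ((hdist k i hi j hj).trans_lt hδ3)).le
  refine add_le_add_right (ENNReal.ofReal_le_ofReal ?_) _
  set A := (∑ i : Fin n, v i) / (n : ℝ) with hA
  have hA0 : 0 ≤ A := div_nonneg (Finset.sum_nonneg fun i _ => (hv i).le) hn'.le
  have hAC : A ≤ C := hCn.trans (le_max_left _ _)
  have e : (∑ i : Fin n, (β * v i + α ^ 2 + 6 * (v i / N) + 4 * δ)) / (n : ℝ) =
      β * A + α ^ 2 + 6 * (A / N) + 4 * δ := by
    simp only [Finset.sum_add_distrib, ← Finset.mul_sum, ← Finset.sum_div, Finset.sum_const,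
      nsmul_eq_mul, Finset.card_univ, Fintype.card_fin, hA]
    field_simp
  have t1 : β * A ≤ η / 6 := by
    rw [hβ, div_mul_eq_mul_div, div_le_div_iff₀ (by positivity) (by norm_num)]
    nlinarith
  have t2 : α ^ 2 = η / 6 := Real.sq_sqrt (by positivity)
  have t3 : 6 * (A / N) ≤ η / 6 := by
    rw [div_le_iff₀ hη] at hNC
    have : A / N ≤ η / 36 := by
      rw [div_le_div_iff₀ hNpos (by norm_num)]; linarith
    linarith
  rw [e]
  linarith

/-- The excess of the conditional risk over that of the oracle is at most a vanishing sequence. -/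
theorem exists_condRisk_le (κ : Kernel ℝ ℝ) [IsMarkovKernel κ] {S : Set ℝ} {v : ℕ → ℝ}
    {m : ℕ → ℕ} {J : ∀ n, Fin (m n) → Set ℝ} (hS : S ⊆ Set.Ioi 0) (hvS : ∀ i, v i ∈ S)
    (ha : UniformContinuousOn (aStar κ) S) (hb : UniformContinuousOn (bStar κ) S)
    (hJ : ∀ n, IsBinning (J n)) (hloc : LocalCond v m J) :
    ∃ ε : ℕ → ℝ≥0, Tendsto ε atTop (𝓝 0) ∧
      ∀ n : ℕ, condRisk κ (J n) (fun i : Fin n => v i) ≤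
        (∑ i : Fin n, condBayesRisk κ (aStar κ) (bStar κ) (v i)) / (n : ℝ≥0∞) +
          (ε n : ℝ≥0∞) := by
  set R : ℕ → ℝ≥0∞ := fun n =>
    (∑ i : Fin n, condBayesRisk κ (aStar κ) (bStar κ) (v i)) / (n : ℝ≥0∞) with hR
  -- Truncated subtraction gives the positive part of the excess. It is finite because the
  -- conditional risk is, so it serves as the error sequence.
  set D : ℕ → ℝ≥0∞ := fun n => condRisk κ (J n) (fun i : Fin n => v i) - R n with hD
  have hDtop : ∀ n, D n ≠ ∞ := fun n =>
    (tsub_le_self.trans_lt (condRisk_lt_top κ (hJ n) fun i : Fin n => hS (hvS i))).ne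
  have hlim : Tendsto D atTop (𝓝 0) := by
    rw [ENNReal.tendsto_nhds_zero]
    intro η hη
    rcases eq_or_ne η ∞ with rfl | hη'
    · simp
    filter_upwards [eventually_condRisk_le κ hS hvS ha hb hJ hloc (ENNReal.toReal_pos hη.ne' hη')]
      with n hn
    rw [ENNReal.ofReal_toReal hη'] at hn
    exact tsub_le_iff_left.2 hn
  refine ⟨fun n => (D n).toNNReal, ?_, fun n => ?_⟩
  · exact (ENNReal.tendsto_toNNReal ENNReal.zero_ne_top).comp hlim
  · rw [ENNReal.coe_toNNReal (hDtop n)]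
    exact le_add_tsub

end GroupLinear

end

theorem theorem1 :
    -- deterministic means and variances
    (∀ (n m : ℕ) (J : Fin m → Set ℝ) (V : Fin n → ℝ),
      GroupLinear.IsBinning J → (∀ i, 0 < V i) →
        (∀ θ : Fin n → ℝ,
          GroupLinear.risk V θ (GroupLinear.glEstimator J V) ≤ GroupLinear.risk V θ (fun x => x) ∧
          GroupLinear.risk V θ (fun x => x) = ENNReal.ofReal ((∑ i, V i) / (n : ℝ))) ∧
        GroupLinear.IsMinimax V (GroupLinear.glEstimator J V)) ∧
    -- i.i.d. model, with `κ` a regular conditional distribution of the mean given the variance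
    (∀ (Ω : Type*) [MeasurableSpace Ω] (P : Measure Ω) [IsProbabilityMeasure P]
      (X θ V : ℕ → Ω → ℝ) (κ : Kernel ℝ ℝ) [IsMarkovKernel κ],
      GroupLinear.IsIIDModel P X θ V → HasCondDistrib (θ 0) (V 0) κ P →
        -- `sampleKernel κ n` is the conditional law of the sample given the variances
        (∀ n : ℕ, HasCondDistrib (fun ω (i : Fin n) => (θ i ω, X i ω))
          (fun ω (i : Fin n) => V i ω) (GroupLinear.sampleKernel κ n) P) ∧
        -- the oracle inequality conditionally on the variances
        (∀ (S : Set ℝ) (v : ℕ → ℝ) (m : ℕ → ℕ) (J : ∀ n, Fin (m n) → Set ℝ),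
          S ⊆ Set.Ioi 0 → (∀ i, v i ∈ S) →
          UniformContinuousOn (GroupLinear.aStar κ) S →
          UniformContinuousOn (GroupLinear.bStar κ) S →
          (∀ n, GroupLinear.IsBinning (J n)) → GroupLinear.LocalCond v m J →
            ∃ ε : ℕ → ℝ≥0, Tendsto ε atTop (𝓝 0) ∧
              ∀ n : ℕ, GroupLinear.condRisk κ (J n) (fun i : Fin n => v i) ≤
                (∑ i : Fin n, GroupLinear.condBayesRisk κ (GroupLinear.aStar κ)
                  (GroupLinear.bStar κ) (v i)) / (n : ℝ≥0∞) + (ε n : ℝ≥0∞))) := by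
  refine ⟨fun n m J V hJ hV => ⟨fun θ => ⟨?_, GroupLinear.risk_id hV θ⟩,
    GroupLinear.isMinimax_glEstimator hJ hV⟩, fun Ω _ P _ X θ V κ _ h hκ =>
    ⟨GroupLinear.hasCondDistrib_sampleKernel h hκ, fun S v m J hS hvS ha hb hJ hloc =>
      GroupLinear.exists_condRisk_le κ hS hvS ha hb hJ hloc⟩⟩
  rw [GroupLinear.risk_id hV]
  exact GroupLinear.risk_glEstimator_le hJ hV θ
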